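/- Let $\mathbb G$ be a Carnot group of step $k$, i.e. the simply connected nilpotent Lie group of a finite-dimensional real Lie algebra $\mathfrak g=V_1\oplus\dots\oplus V_k$ with $[V_1,V_j]=V_{j+1}$ for $1\le j<k$, $[V_1,V_k]=0$, $V_k\neq 0$. Identify $\mathbb G$ with $\mathfrak g$ through the exponential map, so that $xy=\log(\exp x\,\exp y)$ for $x,y\in\mathfrak g$ is given by the Baker–Campbell–Hausdorff formula, and fix an inner product on $\mathfrak g$. Assume that $\dim\mathfrak g$ is odd. A set $D\subset\mathfrak g$ is a smooth open set if it is open and each $p\in\partial D$ has an open neighbourhood $U$ with a function $\rho\in C^\infty(U)$, $d\rho\ne0$ on $U$, such that $D\cap U=\{\rho<0\}$. A $T$-family is a family $\mathcal F$ of smooth open subsets of $\mathfrak g$ such that (i) for every $F\in\mathcal F$ the boundary $\partial F$ is diffeomorphic to the unit sphere of $\mathfrak g$, and (ii) $xF\in\mathcal F$ for all $x\in\mathfrak g$ and $F\in\mathcal F$. **(a) Tangency.** Let $D\subset\mathfrak g$ be a smooth open set and let $\mathcal F$ be a nonempty $T$-family. Then $D$ is tangent to $\mathcal F$: for every $x\in\partial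 D$ there is $F\in\mathcal F$ with $x\in\partial F$ and $T_x\partial F=T_x\partial D$. **(b) Step two.** Let $k=2$. For $\xi=\xi_1+\xi_2$, $\xi_i\in V_i$, let $N(\xi)=(|\xi_1|^4+16|\xi_2|^2)^{1/4}$ be the gauge, and let $B(x,r)=\{y: N(x^{-1}y)<r\}$ be the gauge pseudo-balls. Let $D$ be a convex set (as a subset of the vector space $\mathfrak g$). Then for every $x_0\in\partial D$ and every $r>0$ there is $x_1$ such that $$x_0\in\partial B(x_1,r),\qquad B(x_1,r)\cap D=\varnothing .\tag{$*$}$$ Moreover, if $D$ is also bounded, then it satisfies the uniform outer gauge pseudo-ball condition: there is $R_0>0$ such that for every $x_0\in\partial D$ and every $0<r<R_0$ there is $x_1$ for which $(*)$ holds. -/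

import Mathlib

open scoped ContDiff Topology Nat

noncomputable section

namespace Carnot

/-! ### Lie algebras with a Euclidean structure -/

/-- A Lie ring whose underlying additive group is normed. (One class, so that the Lie ring and the
norm share their additive group.) No compatibility of bracket and norm is required. -/
class NormedLieRing (g : Type*) extends NormedAddCommGroup g, LieRing g

/-- A real Lie algebra endowed with an inner product, the two structures having the same scalar
multiplication. No compatibility of bracket and inner product is required. -/
class EuclideanLieAlgebra (g : Type*) [NormedLieRing g] extends
  InnerProductSpace ℝ g, LieAlgebra ℝ g

/-- A stratification `g = V₁ ⊕ ⋯ ⊕ V_k` of step `k` of a Lie algebra: `[V₁, V_j] = V_{j+1}` for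
`1 ≤ j < k`, `[V₁, V_k] = 0` and `V_k ≠ 0`. The layers are indexed by `ℕ`, and `V_j = 0` unless
`1 ≤ j ≤ k`. -/
structure Stratification (g : Type*) [NormedLieRing g] [EuclideanLieAlgebra g] (k : ℕ) where
  layer : ℕ → Submodule ℝ g
  isInternal : DirectSum.IsInternal layer
  layer_zero : layer 0 = ⊥
  layer_step_ne_bot : layer k ≠ ⊥
  layer_eq_bot : ∀ j, k < j → layer j = ⊥
  span_bracket : ∀ j, 1 ≤ j →
    Submodule.span ℝ {z : g | ∃ x ∈ layer 1, ∃ y ∈ layer j, z = ⁅x, y⁆} = layer (j + 1)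

/-! ### Smooth sets in a Euclidean space -/

section Smooth

variable {E : Type*} [NormedAddCommGroup E] [InnerProductSpace ℝ E]

/-- A smooth open set: an open set which, near each of its boundary points, is the sublevel set
`{ρ < 0}` of a smooth function `ρ` without critical points. -/
def IsSmoothOpen (D : Set E) : Prop :=
  IsOpen D ∧ ∀ p ∈ frontier D, ∃ U : Set E, IsOpen U ∧ p ∈ U ∧ ∃ ρ : E → ℝ,
    ContDiffOn ℝ ∞ ρ U ∧ (∀ q ∈ U, fderiv ℝ ρ q ≠ 0) ∧ D ∩ U = {q ∈ U | ρ q < 0}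

/-- The tangent space `T_p M` of `M` at `p`: the velocities at `p` of the smooth curves that lie
in `M`. -/
def tangentSpaceAt (M : Set E) (p : E) : Set E :=
  {v | ∃ γ : ℝ → E, ContDiffAt ℝ ∞ γ 0 ∧ γ 0 = p ∧ deriv γ 0 = v ∧ ∀ᶠ t in 𝓝 (0 : ℝ), γ t ∈ M}

/-- `f` is smooth on the (arbitrary) subset `A`: locally it is the restriction of a smooth
function defined on an open set. -/
def IsSmoothOnSubset (f : E → E) (A : Set E) : Prop :=
  ∀ a ∈ A, ∃ U : Set E, IsOpen U ∧ a ∈ U ∧ ∃ h : E → E,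
    ContDiffOn ℝ ∞ h U ∧ Set.EqOn f h (A ∩ U)

/-- The subsets `A` and `B` are diffeomorphic: there are mutually inverse bijections between them,
both smooth. -/
def AreDiffeomorphic (A B : Set E) : Prop :=
  ∃ f h : E → E, Set.MapsTo f A B ∧ Set.MapsTo h B A ∧ Set.InvOn h f A B ∧
    IsSmoothOnSubset f A ∧ IsSmoothOnSubset h B

/-- `D` is tangent to the family `ℱ`: at every `x ∈ ∂D` some member `F` of `ℱ` has `x ∈ ∂F` and
`T_x ∂F = T_x ∂D`. -/
def IsTangentTo (D : Set E) (ℱ : Set (Set E)) : Prop :=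
  ∀ x ∈ frontier D, ∃ F ∈ ℱ, x ∈ frontier F ∧
    tangentSpaceAt (frontier F) x = tangentSpaceAt (frontier D) x

end Smooth

/-! ### The Carnot group of a stratified Lie algebra -/

section Group

variable {g : Type*} [NormedLieRing g] [EuclideanLieAlgebra g]

/-- `exp (ad x)` in a Lie algebra of step `k`, where `(ad x) ^ j = 0` for `j ≥ k`. -/
def expAd (k : ℕ) (x : g) : Module.End ℝ g :=
  ∑ i ∈ Finset.range (k + 1), ((i ! : ℝ))⁻¹ • (LieAlgebra.ad ℝ g x) ^ i

/-- The coefficients of `w log w / (w - 1) = ∑ m, c m * (w - 1) ^ m`. -/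
def bchCoeff (m : ℕ) : ℝ := if m = 0 then 1 else (-1) ^ (m + 1) / ((m : ℝ) * ((m : ℝ) + 1))

/-- The group law `log (exp x * exp y)` of the Carnot group, read in its Lie algebra of step `k`
through the exponential map, by the Baker-Campbell-Hausdorff formula in integral form:
`x + ∫₀¹ ψ (exp (ad x) ∘ exp (t ad y)) y dt` with `ψ w = w log w / (w - 1)`. All series are finite,
since `exp (ad x) ∘ exp (t ad y) - 1` raises the lower central series. The unit is `0` and the
inverse of `x` is `-x`; for `k = 2` the law is `x + y + (1/2) [x, y]`. -/
def mul (k : ℕ) (x y : g) : g :=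
  x + ∫ t in (0 : ℝ)..1, ∑ m ∈ Finset.range (k + 1),
    bchCoeff m • ((expAd k x * expAd k (t • y) - 1) ^ m) y

namespace Stratification

/-- A `T`-family in the Lie algebra `g` of a Carnot group: smooth open subsets of `g` with boundary
diffeomorphic to the unit sphere of `g`, the family being invariant under left translations. -/
structure IsTFamily {k : ℕ} (_S : Stratification g k) (ℱ : Set (Set g)) : Prop where
  isSmoothOpen : ∀ F ∈ ℱ, IsSmoothOpen F
  diffeomorphic : ∀ F ∈ ℱ, AreDiffeomorphic (frontier F) (Metric.sphere (0 : g) 1)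
  left_invariant : ∀ x : g, ∀ F ∈ ℱ, mul k x '' F ∈ ℱ

/-- The component of `x` in the layer `V_j`. -/
def component {k : ℕ} (S : Stratification g k) (j : ℕ) (x : g) : g :=
  (((LinearEquiv.ofBijective (DirectSum.coeLinearMap S.layer) S.isInternal).symm x) j : S.layer j)

/-- The gauge `N (ξ₁ + ξ₂) = (|ξ₁|⁴ + 16 |ξ₂|²) ^ (1/4)`, `ξ₁ ∈ V₁`, `ξ₂ ∈ V₂`, of a Carnot group
of step two. -/
def gauge (S : Stratification g 2) (x : g) : ℝ :=
  (‖S.component 1 x‖ ^ 4 + 16 * ‖S.component 2 x‖ ^ 2) ^ ((1 : ℝ) / 4)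

/-- The gauge pseudo-ball `B(x, r) = {y | N (x⁻¹ y) < r}`. -/
def gaugeBall (S : Stratification g 2) (x : g) (r : ℝ) : Set g :=
  {y | S.gauge (mul 2 (-x) y) < r}

/-- There is a gauge pseudo-ball `B = B(x₁, r)` of radius `r` that is tangent to `∂D` at `x₀` from
the outside: `x₀ ∈ ∂B` and `B ∩ D = ∅`. -/
def HasOuterGaugeBall (S : Stratification g 2) (D : Set g) (x₀ : g) (r : ℝ) : Prop :=
  ∃ x₁ : g, x₀ ∈ frontier (S.gaugeBall x₁ r) ∧ S.gaugeBall x₁ r ∩ D = ∅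

/-- The uniform outer gauge pseudo-ball condition. -/
def UniformOuterGaugeBall (S : Stratification g 2) (D : Set g) : Prop :=
  ∃ R₀ > 0, ∀ x₀ ∈ frontier D, ∀ r, 0 < r → r < R₀ → S.HasOuterGaugeBall D x₀ r

end Stratification

end Group

end Carnot

end

/-! Tangency. Fix a member F of the family, a point x of ∂D, and let α be the differential at x of a
defining function of D. Every y in ∂F is carried to x by exactly one left translation, by z(y) say,
and z is smooth. The translate of F by z(y) has tangent space ker α at x exactly when T_y∂F is the
kernel of α ∘ A(y), where A(y) is the differential at y of the translation by z(y). The gradients of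
these functionals form a smooth, nowhere vanishing field. Its projection to T∂F is a smooth tangent
field on a copy of an even-dimensional sphere, so it has a zero, and there the field is normal to ∂F
(`exists_tangentSpaceAt_eq`).

Associativity of the group law is not needed, only that it is smooth and can be divided smoothly on
both sides. Modulo deeper layers the law is addition, so division is a fixed point problem that
stops after k iterations (`exists_smooth_inverse`).

The hairy ball theorem is proved by Milnor's volume argument. Extend a unit tangent field to v,
homogeneous of degree one. For small t the map x + t v(x) carries the unit ball, without its centre,
onto the ball of radius √(1+t²), without its centre. By change of variables the volume of the image
is a polynomial in t, but (1+t²)^(n/2) is not one when n is odd.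

Step two. A supporting functional l reduces the claim to a half-space. Write x₀ = x₁z with z on the
gauge sphere. Then w ↦ l(x₁w) is affine, and the ball lies in the half-space as soon as the linear
part is an inner normal of the convex set {N < r} at z. This is an equation for z, perturbed by a
skew map J that comes from the bracket. It is solved for each value of a parameter μ > 0, and the
radius is then adjusted by the intermediate value theorem (`exists_tangent_point_gaugeSphere`). -/

namespace Carnot

/-! ### Families that are polynomial in one parameter -/

section PolynomialFamily

variable {P V : Type*} [NormedAddCommGroup P] [NormedSpace ℝ P]
  [NormedAddCommGroup V] [NormedSpace ℝ V]

/-- Families `f t p` that are polynomial in `t`, with coefficients that are smooth in `p`. -/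
inductive IsPolyFamily : (ℝ → P → V) → Prop
  | monomial (i : ℕ) {c : P → V} (hc : ContDiff ℝ ∞ c) : IsPolyFamily fun t p => t ^ i • c p
  | add {f h : ℝ → P → V} (hf : IsPolyFamily f) (hh : IsPolyFamily h) :
      IsPolyFamily fun t p => f t p + h t p

namespace IsPolyFamily

theorem const {c : P → V} (hc : ContDiff ℝ ∞ c) : IsPolyFamily fun (_ : ℝ) p => c p := by
  simpa using IsPolyFamily.monomial 0 hc

theorem param_smul {f : ℝ → P → V} (hf : IsPolyFamily f) :
    IsPolyFamily fun t p => t • f t p := by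
  induction hf with
  | monomial i hc => simpa [smul_smul, pow_succ'] using IsPolyFamily.monomial (i + 1) hc
  | add _ _ h₁ h₂ => simpa only [smul_add] using h₁.add h₂

theorem const_smul (r : ℝ) {f : ℝ → P → V} (hf : IsPolyFamily f) :
    IsPolyFamily fun t p => r • f t p := by
  induction hf with
  | monomial i hc => simpa only [smul_comm r] using IsPolyFamily.monomial i (hc.const_smul r)
  | add _ _ h₁ h₂ => simpa only [smul_add] using h₁.add h₂

theorem sum {ι : Type*} (s : Finset ι) {f : ι → ℝ → P → V} (hf : ∀ i, IsPolyFamily (f i)) :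
    IsPolyFamily fun t p => ∑ i ∈ s, f i t p := by
  classical
  induction s using Finset.induction_on with
  | empty => simpa using IsPolyFamily.const (P := P) (V := V) contDiff_const
  | insert a s ha ih => simpa only [Finset.sum_insert ha] using (hf a).add ih

theorem continuous {f : ℝ → P → V} (hf : IsPolyFamily f) (p : P) :
    Continuous fun t => f t p := by
  induction hf with
  | monomial i hc => fun_prop
  | add _ _ h₁ h₂ => exact h₁.add h₂

/-- Each monomial integrates to a constant times its smooth coefficient, so nothing is
differentiated under the integral sign. This is the purpose of `IsPolyFamily`. -/
theorem contDiff_integral [CompleteSpace V] {f : ℝ → P → V} (hf : IsPolyFamily f) :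
    ContDiff ℝ ∞ fun p => ∫ t in (0 : ℝ)..1, f t p := by
  induction hf with
  | @monomial i c hc =>
    have : ∀ p, _ := fun p => intervalIntegral.integral_smul_const (a := 0) (b := 1)
      (fun t : ℝ => t ^ i) (c p) (μ := MeasureTheory.volume)
    simp only [this]
    exact contDiff_const.smul hc
  | add hf hh h₁ h₂ =>
    have : ∀ p, _ := fun p => intervalIntegral.integral_add (μ := MeasureTheory.volume)
      ((hf.continuous p).intervalIntegrable (0 : ℝ) 1) ((hh.continuous p).intervalIntegrable 0 1)
    simp only [this]
    exact h₁.add h₂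

end IsPolyFamily

end PolynomialFamily

/-! ### Smoothness of the group law -/

section Smoothness

variable {g : Type*} [NormedLieRing g] [EuclideanLieAlgebra g] {P : Type*}
  [NormedAddCommGroup P] [NormedSpace ℝ P]

theorem contDiff_lie [FiniteDimensional ℝ g] {u v : P → g}
    (hu : ContDiff ℝ ∞ u) (hv : ContDiff ℝ ∞ v) :
    ContDiff ℝ ∞ fun p => ⁅u p, v p⁆ := by
  let b : g →L[ℝ] g →L[ℝ] g := LinearMap.toContinuousLinearMap
    ((LinearMap.toContinuousLinearMap (𝕜 := ℝ) (E := g) (F' := g)).toLinearMap ∘ₗ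
      (LieAlgebra.ad ℝ g : g →ₗ[ℝ] Module.End ℝ g))
  exact (b.contDiff.comp hu).clm_apply hv

/-- Families of endomorphisms that preserve `IsPolyFamily`. -/
def IsPolyOperator (A : ℝ → P → Module.End ℝ g) : Prop :=
  ∀ u : ℝ → P → g, IsPolyFamily u → IsPolyFamily fun t p => A t p (u t p)

namespace IsPolyOperator

theorem one : IsPolyOperator fun (_ : ℝ) (_ : P) => (1 : Module.End ℝ g) := fun u hu => by
  simpa using hu

theorem mul {A B : ℝ → P → Module.End ℝ g} (hA : IsPolyOperator A) (hB : IsPolyOperator B) :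
    IsPolyOperator fun t p => A t p * B t p := fun u hu => hA _ (hB u hu)

theorem pow {A : ℝ → P → Module.End ℝ g} (hA : IsPolyOperator A) (n : ℕ) :
    IsPolyOperator fun t p => A t p ^ n := by
  induction n with
  | zero => simpa using one
  | succ n ih => simpa only [pow_succ] using ih.mul hA

theorem sub {A B : ℝ → P → Module.End ℝ g} (hA : IsPolyOperator A) (hB : IsPolyOperator B) :
    IsPolyOperator fun t p => A t p - B t p := fun u hu => by
  simpa [sub_eq_add_neg] using (hA u hu).add ((hB u hu).const_smul (-1))

theorem ad [FiniteDimensional ℝ g] {x : P → g} (hx : ContDiff ℝ ∞ x) :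
    IsPolyOperator fun (_ : ℝ) p => LieAlgebra.ad ℝ g (x p) := fun u hu => by
  simp only [LieAlgebra.ad_apply]
  induction hu with
  | monomial i hc => simpa only [lie_smul] using IsPolyFamily.monomial i (contDiff_lie hx hc)
  | add _ _ h₁ h₂ => simpa only [lie_add] using h₁.add h₂

theorem ad_smul [FiniteDimensional ℝ g] {x : P → g} (hx : ContDiff ℝ ∞ x) :
    IsPolyOperator fun (t : ℝ) p => LieAlgebra.ad ℝ g (t • x p) := fun u hu => by
  simpa using (ad hx u hu).param_smul

theorem expAd (k : ℕ) {x : ℝ → P → g} (hx : IsPolyOperator fun t p => LieAlgebra.ad ℝ g (x t p)) :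
    IsPolyOperator fun t p => expAd k (x t p) := fun u hu => by
  simp only [Carnot.expAd, LinearMap.sum_apply, LinearMap.smul_apply]
  exact IsPolyFamily.sum _ fun i => (hx.pow i u hu).const_smul _

end IsPolyOperator

theorem isPolyFamily_bch [FiniteDimensional ℝ g] (k : ℕ) : IsPolyFamily fun (t : ℝ) (p : g × g) =>
    ∑ m ∈ Finset.range (k + 1), bchCoeff m • ((expAd k p.1 * expAd k (t • p.2) - 1) ^ m) p.2 :=
  IsPolyFamily.sum _ fun m => IsPolyFamily.const_smul _ <|
    ((((IsPolyOperator.ad contDiff_fst).expAd k).mul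
      ((IsPolyOperator.ad_smul contDiff_snd).expAd k)).sub IsPolyOperator.one).pow m _
      (IsPolyFamily.const contDiff_snd)

/-- The group law is smooth. -/
theorem contDiff_mul [FiniteDimensional ℝ g] (k : ℕ) :
    ContDiff ℝ ∞ fun p : g × g => mul k p.1 p.2 :=
  contDiff_fst.add (isPolyFamily_bch k).contDiff_integral

end Smoothness

/-! ### The filtration of a stratified Lie algebra -/

section Filtration

variable {g : Type*} [NormedLieRing g] [EuclideanLieAlgebra g] {k : ℕ}

namespace Stratification

variable (S : Stratification g k)

/-- Brackets with the first layer are given. For the rest, V_{a+1} is spanned by brackets [u, v]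
with u in V₁, and Jacobi gives [[u, v], y] = [u, [v, y]] - [v, [u, y]], where v has the lower degree
a. -/
theorem lie_mem_layer {a b : ℕ} (ha : 1 ≤ a) (hb : 1 ≤ b) {x y : g} (hx : x ∈ S.layer a)
    (hy : y ∈ S.layer b) : ⁅x, y⁆ ∈ S.layer (a + b) := by
  induction a, ha using Nat.le_induction generalizing b x y with
  | base =>
    rw [add_comm, ← S.span_bracket b hb]
    exact Submodule.subset_span ⟨x, hx, y, hy, rfl⟩
  | succ a ha ih =>
    rw [← S.span_bracket a ha] at hx
    induction hx using Submodule.span_induction with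
    | mem x h =>
      obtain ⟨u, hu, v, hv, rfl⟩ := h
      have h1 : ∀ {c : ℕ} {w : g}, 1 ≤ c → w ∈ S.layer c → ⁅u, w⁆ ∈ S.layer (c + 1) :=
        fun {c w} hc hw => by
          rw [← S.span_bracket c hc]
          exact Submodule.subset_span ⟨u, hu, w, hw, rfl⟩
      rw [lie_lie]
      refine sub_mem ?_ ?_
      · have := h1 (by omega) (ih hb hv hy)
        rwa [show a + b + 1 = a + 1 + b by omega] at this
      · have := ih (by omega) hv (h1 hb hy)
        rwa [show a + (b + 1) = a + 1 + b by omega] at this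
    | zero => simp
    | add x x' _ _ h₁ h₂ => rw [add_lie]; exact add_mem h₁ h₂
    | smul r x _ h => rw [smul_lie]; exact Submodule.smul_mem _ _ h

/-- The sum of the layers of index larger than `i`. -/
def filtration (i : ℕ) : Submodule ℝ g := ⨆ j : {j // i < j}, S.layer j

theorem layer_le_filtration {i j : ℕ} (h : i < j) : S.layer j ≤ S.filtration i :=
  le_iSup (fun j : {j // i < j} => S.layer j) ⟨j, h⟩

theorem filtration_anti {i j : ℕ} (h : i ≤ j) : S.filtration j ≤ S.filtration i :=
  iSup_le fun l => S.layer_le_filtration (h.trans_lt l.2)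

theorem filtration_zero : S.filtration 0 = ⊤ := by
  rw [eq_top_iff, ← S.isInternal.submodule_iSup_eq_top]
  refine iSup_le fun j => ?_
  rcases Nat.eq_zero_or_pos j with rfl | hj
  · simp [S.layer_zero]
  · exact S.layer_le_filtration hj

theorem filtration_step : S.filtration k = ⊥ :=
  iSup_eq_bot.2 fun j => S.layer_eq_bot j j.2

/-- Layers of index at least i + 1 and j + 1 bracket into index at least i + j + 2. The gain of one
over i + j is the source of every contraction below. -/
theorem lie_mem_filtration {i j : ℕ} {x y : g} (hx : x ∈ S.filtration i)
    (hy : y ∈ S.filtration j) : ⁅x, y⁆ ∈ S.filtration (i + j + 1) := by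
  induction hx using Submodule.iSup_induction' with
  | zero => simp
  | add x x' _ _ h₁ h₂ => rw [add_lie]; exact add_mem h₁ h₂
  | mem a x hx =>
    induction hy using Submodule.iSup_induction' with
    | zero => simp
    | add y y' _ _ h₁ h₂ => rw [lie_add]; exact add_mem h₁ h₂
    | mem b y hy =>
      have := a.2
      have := b.2
      exact S.layer_le_filtration (by omega) (S.lie_mem_layer (by omega) (by omega) hx hy)

/-- Endomorphisms that agree up to an endomorphism raising the filtration by `i + 1`. -/
def OpCongr (i : ℕ) (A B : Module.End ℝ g) : Prop :=
  ∀ j, ∀ v ∈ S.filtration j, A v - B v ∈ S.filtration (i + j + 1)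

variable {S}

namespace OpCongr

variable {i : ℕ} {A A' B B' : Module.End ℝ g}

theorem refl (A : Module.End ℝ g) : S.OpCongr i A A := fun j v _ => by simp

theorem mem (h : S.OpCongr 0 A 1) {j : ℕ} {v : g} (hv : v ∈ S.filtration j) :
    A v ∈ S.filtration j := by
  have := add_mem (S.filtration_anti (by omega) (h j v hv)) hv
  simpa using this

/-- AB - A'B' = (A - A')B + A'(B - B'). -/
theorem mul (hA : S.OpCongr i A A') (hB : S.OpCongr i B B')
    (hB₀ : ∀ j, ∀ v ∈ S.filtration j, B v ∈ S.filtration j)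
    (hA₀ : ∀ j, ∀ v ∈ S.filtration j, A' v ∈ S.filtration j) :
    S.OpCongr i (A * B) (A' * B') := fun j v hv => by
  have := add_mem (hA j _ (hB₀ j v hv)) (hA₀ _ _ (hB j v hv))
  simpa using this

theorem pow_mem (hA : ∀ j, ∀ v ∈ S.filtration j, A v ∈ S.filtration j) (n : ℕ) :
    ∀ j, ∀ v ∈ S.filtration j, (A ^ n) v ∈ S.filtration j := by
  induction n with
  | zero => simp
  | succ n ih => intro j v hv; rw [pow_succ']; exact hA _ _ (ih j v hv)

theorem pow (hA : S.OpCongr i A A') (hA₀ : ∀ j, ∀ v ∈ S.filtration j, A v ∈ S.filtration j)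
    (hA₀' : ∀ j, ∀ v ∈ S.filtration j, A' v ∈ S.filtration j) (n : ℕ) :
    S.OpCongr i (A ^ n) (A' ^ n) := by
  induction n with
  | zero => simpa using refl 1
  | succ n ih =>
    rw [pow_succ', pow_succ']
    exact hA.mul ih (pow_mem hA₀ n) hA₀'

theorem sub_one (hA : S.OpCongr i A A') : S.OpCongr i (A - 1) (A' - 1) := fun j v hv => by
  simpa using hA j v hv

theorem expAd (n : ℕ) {x x' : g} (h : x - x' ∈ S.filtration i) :
    S.OpCongr i (expAd n x) (expAd n x') := fun j v hv => by
  simp only [Carnot.expAd, LinearMap.sum_apply, LinearMap.smul_apply, ← Finset.sum_sub_distrib,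
    ← smul_sub]
  have had : ∀ (z : g) (j), ∀ v ∈ S.filtration j, LieAlgebra.ad ℝ g z v ∈ S.filtration j :=
    fun z j v hv => S.filtration_anti (by omega)
      (S.lie_mem_filtration (i := 0) (x := z) (by simp [S.filtration_zero]) hv)
  refine Submodule.sum_mem _ fun m _ => Submodule.smul_mem _ _ (pow ?_ (had x) (had x') m j v hv)
  intro j v hv
  simpa using S.lie_mem_filtration h hv

theorem expAd_one (n : ℕ) (x : g) : S.OpCongr 0 (Carnot.expAd n x) 1 := by
  have h0 : Carnot.expAd n (0 : g) = 1 := by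
    rw [Carnot.expAd, Finset.sum_eq_single 0] <;> simp +contextual [zero_pow]
  rw [← h0]
  exact expAd n (by simp [S.filtration_zero])

end OpCongr

variable (S)

theorem opCongr_bch_one (n : ℕ) (x y : g) : S.OpCongr 0 (expAd n x * expAd n y) 1 := by
  have := (OpCongr.expAd_one (S := S) n x).mul (OpCongr.expAd_one n y)
    (fun j v hv => (OpCongr.expAd_one n y).mem hv) (fun j v hv => by simpa using hv)
  simpa using this

theorem bch_mem_filtration (n : ℕ) (x y : g) {j : ℕ} {v : g} (hv : v ∈ S.filtration j) :
    (expAd n x * expAd n y - 1) v ∈ S.filtration (j + 1) := by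
  simpa using S.opCongr_bch_one n x y j v hv

theorem opCongr_bch_pow (n : ℕ) {i : ℕ} {x x' y y' : g} (hx : x - x' ∈ S.filtration i)
    (hy : y - y' ∈ S.filtration i) (m : ℕ) :
    S.OpCongr i ((expAd n x * expAd n y - 1) ^ m) ((expAd n x' * expAd n y' - 1) ^ m) :=
  OpCongr.pow (((OpCongr.expAd n hx).mul (OpCongr.expAd n hy)
    (fun _ _ hv => (OpCongr.expAd_one n y).mem hv)
    (fun _ _ hv => (OpCongr.expAd_one n x').mem hv)).sub_one)
    (fun _ _ hv => S.filtration_anti (by omega) (S.bch_mem_filtration n x y hv))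
    (fun _ _ hv => S.filtration_anti (by omega) (S.bch_mem_filtration n x' y' hv)) m

/-- The term m = 0 contributes exactly y - y'. For m ≥ 1 the change of the operator gains a level by
`opCongr_bch_pow`, and the operator applied to y - y' gains one because it raises the filtration. -/
theorem bch_sub_mem_filtration (n : ℕ) (t : ℝ) {i : ℕ} {x x' y y' : g}
    (hx : x - x' ∈ S.filtration i) (hy : y - y' ∈ S.filtration i) (m : ℕ) :
    bchCoeff m • ((expAd n x * expAd n (t • y) - 1) ^ m) y -
      bchCoeff m • ((expAd n x' * expAd n (t • y') - 1) ^ m) y' -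
      (if m = 0 then y - y' else 0) ∈ S.filtration (i + 1) := by
  rcases Nat.eq_zero_or_pos m with rfl | hm
  · simp [bchCoeff]
  · obtain ⟨m, rfl⟩ := Nat.exists_eq_succ_of_ne_zero hm.ne'
    rw [if_neg (Nat.succ_ne_zero m), sub_zero, ← smul_sub]
    refine Submodule.smul_mem _ _ ?_
    have hty : t • y - t • y' ∈ S.filtration i := by
      rw [← smul_sub]; exact Submodule.smul_mem _ _ hy
    have h1 := S.opCongr_bch_pow n hx hty (m + 1) 0 y (by simp [S.filtration_zero])
    have h2 : ((expAd n x' * expAd n (t • y') - 1) ^ (m + 1)) (y - y') ∈ S.filtration (i + 1) := by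
      rw [pow_succ]
      exact OpCongr.pow_mem (fun _ _ hv => S.filtration_anti (by omega)
        (S.bch_mem_filtration n x' (t • y') hv)) m _ _ (S.bch_mem_filtration n x' (t • y') hy)
    have := add_mem h1 h2
    simpa using this

/-- Contraction principle for the filtration: each application of T gains a level and level k is
zero, so `T^[k]` is constant and its value is the only fixed point. -/
theorem iterate_fixed {T : g → g}
    (hT : ∀ i, ∀ x y, x - y ∈ S.filtration i → T x - T y ∈ S.filtration (i + 1)) :
    (∀ x, T (T^[k] x) = T^[k] x) ∧ ∀ x y, T y = y → T^[k] x = y := by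
  have h : ∀ n x y, T^[n] x - T^[n] y ∈ S.filtration n := fun n x y => by
    induction n with
    | zero => simp [S.filtration_zero]
    | succ n ih =>
      simp only [Function.iterate_succ_apply']
      exact hT n _ _ ih
  have h0 : ∀ x y, T^[k] x = T^[k] y := fun x y => by
    have := h k x y
    rwa [S.filtration_step, Submodule.mem_bot, sub_eq_zero] at this
  refine ⟨fun x => ?_, fun x y hy => ?_⟩
  · rw [← Function.iterate_succ_apply' T, Function.iterate_succ_apply]
    exact h0 _ _
  · rw [h0 x y]
    exact Function.iterate_fixed hy k

/-- A solution y of Φ z y = w is a fixed point of y ↦ y + w - Φ z y. Its k-th iterate from 0 is a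
finite composition of smooth maps, hence smooth jointly in z and w. -/
theorem exists_smooth_inverse {Φ : g → g → g} (hΦ : ContDiff ℝ ∞ fun p : g × g => Φ p.1 p.2)
    (h : ∀ i z x y, x - y ∈ S.filtration i →
      Φ z x - Φ z y - (x - y) ∈ S.filtration (i + 1)) :
    ∃ d : g × g → g, ContDiff ℝ ∞ d ∧ (∀ z w, Φ z (d (z, w)) = w) ∧ ∀ z y, d (z, Φ z y) = y := by
  have hT : ∀ z w : g, (∀ x, _) ∧ ∀ x y, _ → _ := fun z w =>
    S.iterate_fixed (T := fun y => y + w - Φ z y) fun i x y hxy => by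
      have := neg_mem (h i z x y hxy)
      convert this using 1
      abel
  refine ⟨fun p => (fun y => y + p.2 - Φ p.1 y)^[k] 0, ?_, fun z w => ?_, fun z y => ?_⟩
  · have : ∀ n, ContDiff ℝ ∞ fun p : g × g => (fun y => y + p.2 - Φ p.1 y)^[n] 0 := fun n => by
      induction n with
      | zero => exact contDiff_const
      | succ n ih =>
        simp only [Function.iterate_succ_apply']
        exact (ih.add contDiff_snd).sub (hΦ.comp (contDiff_fst.prodMk ih))
    exact this k
  · have := (hT z w).1 0
    dsimp only at this ⊢
    rw [add_sub_assoc, add_eq_left, sub_eq_zero] at this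
    exact this.symm
  · exact (hT z (Φ z y)).2 0 y (by abel)

/-! ### Division in the group -/

variable [FiniteDimensional ℝ g]

theorem integral_mem_submodule {V : Type*} [NormedAddCommGroup V] [NormedSpace ℝ V]
    [FiniteDimensional ℝ V] (F : Submodule ℝ V) {f : ℝ → V} (hf : Continuous f)
    (h : ∀ t, f t ∈ F) (a b : ℝ) : ∫ t in a..b, f t ∈ F := by
  by_contra hn
  obtain ⟨l, hl, hF⟩ := F.exists_le_ker_of_notMem hn
  refine hl ?_
  have h1 := (LinearMap.toContinuousLinearMap l).intervalIntegral_comp_comm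
    (hf.intervalIntegrable (μ := MeasureTheory.volume) a b)
  have h2 : ∀ t, LinearMap.toContinuousLinearMap l (f t) = 0 := fun t => hF (h t)
  simp only [h2, intervalIntegral.integral_zero] at h1
  exact h1.symm

/-- The group law is the addition up to terms that are deeper in the filtration. -/
theorem mul_sub_mem_filtration {i : ℕ} {x x' y y' : g}
    (hx : x - x' ∈ S.filtration i) (hy : y - y' ∈ S.filtration i) :
    mul k x y - mul k x' y' - (x - x') - (y - y') ∈ S.filtration (i + 1) := by
  have hb : ∀ x y : g, Continuous fun t : ℝ => ∑ m ∈ Finset.range (k + 1),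
      bchCoeff m • ((expAd k x * expAd k (t • y) - 1) ^ m) y :=
    fun x y => (isPolyFamily_bch (g := g) k).continuous (x, y)
  have hc := hb x y
  have hc' := hb x' y'
  have h := integral_mem_submodule (S.filtration (i + 1))
    (f := fun t => (∑ m ∈ Finset.range (k + 1),
      bchCoeff m • ((expAd k x * expAd k (t • y) - 1) ^ m) y) - (∑ m ∈ Finset.range (k + 1),
      bchCoeff m • ((expAd k x' * expAd k (t • y') - 1) ^ m) y') - (y - y'))
    ((hc.sub hc').sub continuous_const) (fun t => by
      have := Submodule.sum_mem (S.filtration (i + 1)) (t := Finset.range (k + 1))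
        (fun m _ => S.bch_sub_mem_filtration k t hx hy m)
      rw [Finset.sum_sub_distrib, Finset.sum_sub_distrib] at this
      simpa using this) 0 1
  rw [intervalIntegral.integral_sub ((hc.fun_sub hc').intervalIntegrable _ _)
      (continuous_const.intervalIntegrable _ _),
    intervalIntegral.integral_sub (hc.intervalIntegrable _ _) (hc'.intervalIntegrable _ _)] at h
  simp only [intervalIntegral.integral_const, sub_zero, one_smul] at h
  convert h using 1
  simp only [mul]
  abel

/-- Left translations are diffeomorphisms, jointly in all variables. -/
theorem exists_leftDivision (S : Stratification g k) : ∃ d : g × g → g, ContDiff ℝ ∞ d ∧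
    (∀ z w, mul k z (d (z, w)) = w) ∧ ∀ z y, d (z, mul k z y) = y :=
  S.exists_smooth_inverse (contDiff_mul k) fun i z x y hxy => by
    simpa using S.mul_sub_mem_filtration (x := z) (x' := z) (by simp) hxy

/-- The equation `z * y = w` can be solved smoothly for `z`. -/
theorem exists_rightDivision (S : Stratification g k) : ∃ d : g × g → g, ContDiff ℝ ∞ d ∧
    ∀ y w, mul k (d (y, w)) y = w := by
  obtain ⟨d, hd, h, -⟩ := S.exists_smooth_inverse (Φ := fun y z => mul k z y)
    ((contDiff_mul k).comp (contDiff_snd.prodMk contDiff_fst)) fun i y x x' hx => by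
      simpa using S.mul_sub_mem_filtration (y := y) (y' := y) hx (by simp)
  exact ⟨d, hd, h⟩

end Stratification

end Filtration

/-! ### The hairy ball theorem -/

section HairyBall

open Polynomial in
/-- An odd power of `1 + X ^ 2` is not a square, up to a constant. -/
theorem sq_ne_C_mul_one_add_X_sq_pow {n : ℕ} (hn : Odd n) {c : ℝ} (hc : c ≠ 0) (q : ℝ[X]) :
    q ^ 2 ≠ C c * (1 + X ^ 2) ^ n := by
  intro h
  -- Over ℂ the root i has even multiplicity on the left and the odd multiplicity n on the right.
  have h1 := congrArg (Polynomial.map Complex.ofRealHom) h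
  simp only [Polynomial.map_mul, Polynomial.map_pow, Polynomial.map_add, Polynomial.map_one,
    map_X, map_C] at h1
  have hf : (1 + X ^ 2 : ℂ[X]) = (X - C Complex.I) * (X - C (-Complex.I)) := by
    have : (C Complex.I * C Complex.I : ℂ[X]) = -1 := by
      rw [← C_mul, Complex.I_mul_I]; simp
    rw [C_neg]
    linear_combination this
  have h2 := congrArg (fun p : ℂ[X] => p.roots.count Complex.I) h1
  have hc' : Complex.ofRealHom c ≠ 0 := by simpa using hc
  rw [hf] at h2
  simp only [roots_pow, roots_C_mul _ hc', Multiset.count_nsmul] at h2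
  rw [roots_mul (mul_ne_zero (X_sub_C_ne_zero _) (X_sub_C_ne_zero _)), roots_X_sub_C,
    roots_X_sub_C, Multiset.count_add] at h2
  have hI : Complex.I ≠ -Complex.I := fun h => by
    have := congrArg Complex.im h
    norm_num at this
  rw [Multiset.count_singleton_self, Multiset.count_singleton, if_neg hI] at h2
  obtain ⟨m, rfl⟩ := hn
  omega

variable {E : Type*} [NormedAddCommGroup E]

open Polynomial in
theorem exists_polynomial_eval_eq_det [NormedSpace ℝ E] [FiniteDimensional ℝ E] (A : E →L[ℝ] E) :
    ∃ p : ℝ[X], p.degree < (Module.finrank ℝ E + 1 : ℕ) ∧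
      ∀ t : ℝ, p.eval t = (ContinuousLinearMap.id ℝ E + t • A).det := by
  classical
  let b := Module.finBasis ℝ E
  let M := LinearMap.toMatrix b b (A : E →ₗ[ℝ] E)
  refine ⟨((X : ℝ[X]) • M.map C + (1 : Matrix _ _ ℝ).map C).det, ?_, fun t => ?_⟩
  · refine (degree_le_natDegree).trans_lt ?_
    have := natDegree_det_X_add_C_le M 1
    rw [Fintype.card_fin] at this
    exact_mod_cast Nat.lt_succ_of_le this
  · have h1 : (ContinuousLinearMap.id ℝ E + t • A).det =
        (LinearMap.toMatrix b b (LinearMap.id + t • (A : E →ₗ[ℝ] E))).det := by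
      rw [LinearMap.det_toMatrix]; rfl
    rw [h1, map_add, LinearMap.toMatrix_id, map_smul, ← coe_evalRingHom, RingHom.map_det]
    congr 1
    ext i j
    have h2 : ∀ z : ℝ, eval t (C z) = z := fun z => eval_C
    by_cases hij : i = j <;> simp [M, h2, hij] <;> ring

/-- `1 + A` has a positive determinant if `A` is a strict contraction. -/
theorem det_id_add_pos [NormedSpace ℝ E] [FiniteDimensional ℝ E] {A : E →L[ℝ] E}
    (hA : ‖A‖ < 1) : 0 < (ContinuousLinearMap.id ℝ E + A).det := by
  obtain ⟨p, -, hp⟩ := exists_polynomial_eval_eq_det A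
  -- A kernel vector v ≠ 0 of 1 + tA would satisfy |v| = t|Av| < |v|; so the determinant keeps the
  -- sign that it has at t = 0.
  have hne : ∀ t ∈ Set.Icc (0 : ℝ) 1, p.eval t ≠ 0 := fun t ht h0 => by
    rw [hp] at h0
    have : (LinearMap.det ((ContinuousLinearMap.id ℝ E + t • A : E →L[ℝ] E) : E →ₗ[ℝ] E)) = 0 := h0
    obtain ⟨v, hv, hv0⟩ := (LinearMap.bot_lt_ker_of_det_eq_zero this).bot_lt.ne_bot |>
      (Submodule.ne_bot_iff _).1
    have h1 : v + t • A v = 0 := hv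
    have h2 : ‖v‖ = ‖t • A v‖ := by
      conv_lhs => rw [eq_neg_of_add_eq_zero_left h1, norm_neg]
    rw [norm_smul, Real.norm_of_nonneg ht.1] at h2
    have h3 := A.le_opNorm v
    have h4 : 0 < ‖v‖ := norm_pos_iff.2 hv0
    nlinarith [norm_nonneg (A v), ht.2]
  have h0 : p.eval 0 = 1 := by rw [hp]; simp [ContinuousLinearMap.det]
  have h1 : p.eval 1 = (ContinuousLinearMap.id ℝ E + A).det := by rw [hp]; simp
  rw [← h1]
  by_contra hneg
  obtain ⟨t, ht, h⟩ := intermediate_value_Icc' zero_le_one p.continuous.continuousOn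
    (show (0 : ℝ) ∈ Set.Icc (p.eval 1) (p.eval 0) from ⟨not_lt.1 hneg, by rw [h0]; norm_num⟩)
  exact hne t ht h

/-! ### The homogeneous extension of a tangent field and the volume argument -/

variable [InnerProductSpace ℝ E]

/-- The extension of a field on the unit sphere to a homogeneous field of degree one. -/
noncomputable def homogeneousExtension (V : E → E) (x : E) : E := ‖x‖ • V (‖x‖⁻¹ • x)

theorem inv_norm_smul_mem_sphere {x : E} (hx : x ≠ 0) : ‖x‖⁻¹ • x ∈ Metric.sphere (0 : E) 1 := by
  simp [norm_smul, norm_ne_zero_iff.2 hx]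

/-- The radial projection is not Lipschitz near 0; the factor |y|, supplied by the homogeneous
extension, compensates for this. -/
theorem norm_smul_inv_sub_le (x y : E) (hx : x ≠ 0) (hy : y ≠ 0) :
    ‖y‖ * ‖‖x‖⁻¹ • x - ‖y‖⁻¹ • y‖ ≤ 2 * ‖x - y‖ := by
  have hx' := norm_ne_zero_iff.2 hx
  have hy' := norm_ne_zero_iff.2 hy
  have h1 : ‖y‖ • (‖x‖⁻¹ • x - ‖y‖⁻¹ • y) = (‖y‖ - ‖x‖) • ‖x‖⁻¹ • x + (x - y) := by
    rw [smul_sub, sub_smul, smul_smul ‖y‖ ‖y‖⁻¹, mul_inv_cancel₀ hy', smul_smul ‖x‖ ‖x‖⁻¹,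
      mul_inv_cancel₀ hx', one_smul, one_smul]
    abel
  have h2 : ‖y‖ * ‖‖x‖⁻¹ • x - ‖y‖⁻¹ • y‖ = ‖‖y‖ • (‖x‖⁻¹ • x - ‖y‖⁻¹ • y)‖ := by
    rw [norm_smul, norm_norm]
  rw [h2, h1]
  refine (norm_add_le _ _).trans ?_
  have h3 : ‖(‖x‖⁻¹ • x)‖ = 1 := by simpa using inv_norm_smul_mem_sphere hx
  rw [norm_smul, h3, mul_one, Real.norm_eq_abs]
  have := abs_norm_sub_norm_le y x
  rw [norm_sub_rev y x] at this
  linarith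

theorem norm_homogeneousExtension {V : E → E} (h1 : ∀ s ∈ Metric.sphere (0 : E) 1, ‖V s‖ = 1)
    (x : E) : ‖homogeneousExtension V x‖ = ‖x‖ := by
  by_cases hx : x = 0
  · simp [homogeneousExtension, hx]
  · rw [homogeneousExtension, norm_smul, h1 _ (inv_norm_smul_mem_sphere hx), norm_norm, mul_one]

theorem lipschitzWith_homogeneousExtension {V : E → E} {K : NNReal}
    (hV : LipschitzOnWith K V (Metric.sphere 0 1)) (h1 : ∀ s ∈ Metric.sphere (0 : E) 1, ‖V s‖ = 1) :
    LipschitzWith (1 + 2 * K) (homogeneousExtension V) := by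
  have hnorm := norm_homogeneousExtension h1
  have hz : homogeneousExtension V 0 = 0 := by simp [homogeneousExtension]
  have hK : (0 : ℝ) ≤ K := K.2
  refine LipschitzWith.of_dist_le_mul fun x y => ?_
  rw [dist_eq_norm, dist_eq_norm]
  push_cast
  by_cases hx : x = 0
  · rw [hx, hz, zero_sub, zero_sub, norm_neg, norm_neg, hnorm]
    nlinarith [norm_nonneg y]
  by_cases hy : y = 0
  · rw [hy, hz, sub_zero, sub_zero, hnorm]
    nlinarith [norm_nonneg x]
  have h2 : homogeneousExtension V x - homogeneousExtension V y =
      (‖x‖ - ‖y‖) • V (‖x‖⁻¹ • x) + ‖y‖ • (V (‖x‖⁻¹ • x) - V (‖y‖⁻¹ • y)) := by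
    simp only [homogeneousExtension, sub_smul, smul_sub]; abel
  have h3 := hV.dist_le_mul _ (inv_norm_smul_mem_sphere hx) _ (inv_norm_smul_mem_sphere hy)
  rw [dist_eq_norm, dist_eq_norm] at h3
  have h4 := norm_smul_inv_sub_le x y hx hy
  rw [h2]
  refine (norm_add_le _ _).trans ?_
  rw [norm_smul, norm_smul, h1 _ (inv_norm_smul_mem_sphere hx), norm_norm, Real.norm_eq_abs]
  have h5 := abs_norm_sub_norm_le x y
  have h6 := mul_le_mul_of_nonneg_left h3 (norm_nonneg y)
  have h7 := mul_le_mul_of_nonneg_left h4 hK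
  nlinarith

theorem exists_lipschitzOnWith_of_isSmoothOnSubset [FiniteDimensional ℝ E] {V : E → E} {A : Set E}
    (hA : IsCompact A) (hV : IsSmoothOnSubset V A) : ∃ K, LipschitzOnWith K V A := by
  refine LocallyLipschitzOn.exists_lipschitzOnWith_of_compact hA fun s hs => ?_
  obtain ⟨U, hU, hsU, h, hh, heq⟩ := hV s hs
  have h1 : ContDiffAt ℝ 1 h s := ((hh.contDiffAt (hU.mem_nhds hsU)).of_le (by norm_cast))
  obtain ⟨K, t, ht, hK⟩ := h1.exists_lipschitzOnWith
  refine ⟨K, A ∩ (t ∩ U), inter_mem_nhdsWithin _ (Filter.inter_mem ht (hU.mem_nhds hsU)), ?_⟩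
  intro x hx y hy
  rw [heq ⟨hx.1, hx.2.2⟩, heq ⟨hy.1, hy.2.2⟩]
  exact hK hx.2.1 hy.2.1

theorem differentiableAt_homogeneousExtension {V : E → E}
    (hV : IsSmoothOnSubset V (Metric.sphere 0 1)) {x : E} (hx : x ≠ 0) :
    DifferentiableAt ℝ (homogeneousExtension V) x := by
  obtain ⟨U, hU, hsU, h, hh, heq⟩ := hV _ (inv_norm_smul_mem_sphere hx)
  have hn : DifferentiableAt ℝ (fun x : E => ‖x‖) x := (differentiableAt_id.norm ℝ hx)
  have hi : DifferentiableAt ℝ (fun x : E => ‖x‖⁻¹ • x) x :=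
    (hn.inv (norm_ne_zero_iff.2 hx)).smul differentiableAt_id
  have hd : DifferentiableAt ℝ (fun x : E => ‖x‖ • h (‖x‖⁻¹ • x)) x :=
    hn.smul (((hh.contDiffAt (hU.mem_nhds hsU)).differentiableAt (by simp)).comp
      (f := fun x : E => ‖x‖⁻¹ • x) x hi)
  refine hd.congr_of_eventuallyEq ?_
  filter_upwards [hi.continuousAt.preimage_mem_nhds (hU.mem_nhds hsU), isOpen_ne.mem_nhds hx]
    with y hy hy0
  rw [homogeneousExtension, heq ⟨inv_norm_smul_mem_sphere hy0, hy⟩]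

/-- `id + t • v` is a bijection if `v` is Lipschitz and `t` is small. -/
theorem bijective_add_smul [CompleteSpace E] {v : E → E} {K : NNReal} (hv : LipschitzWith K v)
    {t : ℝ} (ht : |t| * K < 1) : Function.Bijective fun x => x + t • v x := by
  -- Solving x + t v(x) = y means finding a fixed point of this contraction.
  have hc : ∀ y, ContractingWith (‖t‖₊ * K) fun x => y - t • v x := fun y => by
    refine ⟨by rw [← NNReal.coe_lt_coe]; simpa using ht, ?_⟩
    refine LipschitzWith.of_dist_le_mul fun a b => ?_
    rw [dist_sub_left, dist_smul₀]
    have := mul_le_mul_of_nonneg_left (hv.dist_le_mul a b) (norm_nonneg t)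
    push_cast
    linarith
  refine ⟨fun a b hab => ?_, fun y => ?_⟩
  · refine (hc (b + t • v b)).fixedPoint_unique' (x := a) (y := b) ?_ ?_
    · change b + t • v b - t • v a = a
      rw [← show a + t • v a = b + t • v b from hab]; abel
    · change b + t • v b - t • v b = b
      abel
  · have h : y - t • v _ = _ := (hc y).fixedPoint_isFixedPt
    exact ⟨_, (eq_sub_iff_add_eq.1 h.symm)⟩

theorem norm_add_smul_of_orthogonal {x w : E} (h : inner ℝ x w = 0) (hw : ‖w‖ = ‖x‖) (t : ℝ) :
    ‖x + t • w‖ = Real.sqrt (1 + t ^ 2) * ‖x‖ := by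
  have h1 : ‖x + t • w‖ ^ 2 = (1 + t ^ 2) * ‖x‖ ^ 2 := by
    rw [norm_add_sq_real, inner_smul_right, h, norm_smul, hw, mul_pow, Real.norm_eq_abs, sq_abs]
    ring
  rw [← Real.sqrt_sq (norm_nonneg (x + t • w)), h1, Real.sqrt_mul (by positivity),
    Real.sqrt_sq (norm_nonneg x)]

theorem inner_homogeneousExtension {V : E → E}
    (h1 : ∀ s ∈ Metric.sphere (0 : E) 1, inner ℝ s (V s) = 0)
    (x : E) : inner ℝ x (homogeneousExtension V x) = 0 := by
  by_cases hx : x = 0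
  · simp [homogeneousExtension, hx]
  · have := h1 _ (inv_norm_smul_mem_sphere hx)
    rw [inner_smul_left] at this
    rw [homogeneousExtension, inner_smul_right]
    have h2 : ‖x‖⁻¹ ≠ 0 := inv_ne_zero (norm_ne_zero_iff.2 hx)
    rw [(mul_eq_zero.1 this).resolve_left (by simpa using h2), mul_zero]

variable [FiniteDimensional ℝ E]

/-- The image of the punctured unit ball under `id + t • v`. -/
theorem image_add_smul_ball {v : E → E} {K : NNReal} (hv : LipschitzWith K v)
    (hn : ∀ x, ‖v x‖ = ‖x‖) (ho : ∀ x, inner ℝ x (v x) = 0) {t : ℝ} (ht : |t| * K < 1) :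
    (fun x => x + t • v x) '' (Metric.ball 0 1 \ {0}) =
      Metric.ball 0 (Real.sqrt (1 + t ^ 2)) \ {0} := by
  have hpos : 0 < Real.sqrt (1 + t ^ 2) := Real.sqrt_pos.2 (by positivity)
  have key : ∀ x, ‖x + t • v x‖ = Real.sqrt (1 + t ^ 2) * ‖x‖ := fun x =>
    norm_add_smul_of_orthogonal (ho x) (hn x) t
  have hiff : ∀ x, x + t • v x ∈ Metric.ball (0 : E) (Real.sqrt (1 + t ^ 2)) \ {0} ↔
      x ∈ Metric.ball (0 : E) 1 \ {0} := fun x => by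
    simp only [Set.mem_sdiff, mem_ball_zero_iff, Set.mem_singleton_iff, ← norm_eq_zero (a := x),
      ← norm_eq_zero (a := x + t • v x), key, mul_eq_zero, hpos.ne', false_or,
      mul_lt_iff_lt_one_right hpos]
  ext y
  constructor
  · rintro ⟨x, hx, rfl⟩
    exact (hiff x).2 hx
  · intro hy
    obtain ⟨x, rfl⟩ := (bijective_add_smul hv ht).2 y
    exact ⟨x, (hiff x).1 hy, rfl⟩

open MeasureTheory in
/-- The volume of the image of the unit ball under `id + t • v`, as an integral. -/
theorem integral_det_id_add_smul [MeasurableSpace E] [BorelSpace E] (μ : Measure E)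
    [μ.IsAddHaarMeasure] [Nontrivial E] {v : E → E} {K : NNReal} (hv : LipschitzWith K v)
    (hn : ∀ x, ‖v x‖ = ‖x‖) (ho : ∀ x, inner ℝ x (v x) = 0)
    (hd : ∀ x, x ≠ 0 → DifferentiableAt ℝ v x) {t : ℝ} (ht : |t| * K < 1) :
    IntegrableOn (fun x => (ContinuousLinearMap.id ℝ E + t • fderiv ℝ v x).det)
      (Metric.ball 0 1 \ {0}) μ ∧
    ∫ x in Metric.ball 0 1 \ {0}, (ContinuousLinearMap.id ℝ E + t • fderiv ℝ v x).det ∂μ =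
      Real.sqrt (1 + t ^ 2) ^ Module.finrank ℝ E * μ.real (Metric.ball 0 1) := by
  have hs : MeasurableSet (Metric.ball (0 : E) 1 \ {0}) :=
    measurableSet_ball.diff (measurableSet_singleton 0)
  have hf : ∀ x ∈ Metric.ball (0 : E) 1 \ {0}, HasFDerivWithinAt (fun x => x + t • v x)
      (ContinuousLinearMap.id ℝ E + t • fderiv ℝ v x) (Metric.ball 0 1 \ {0}) x := fun x hx =>
    ((hasFDerivAt_id x).add ((hd x hx.2).hasFDerivAt.const_smul t)).hasFDerivWithinAt
  have hinj := (bijective_add_smul hv ht).1.injOn (s := Metric.ball (0 : E) 1 \ {0})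
  -- Positivity removes the absolute value from the change of variables formula, which leaves an
  -- integrand polynomial in t.
  have habs : ∀ x, |(ContinuousLinearMap.id ℝ E + t • fderiv ℝ v x).det| • (1 : ℝ) =
      (ContinuousLinearMap.id ℝ E + t • fderiv ℝ v x).det := fun x => by
    rw [smul_eq_mul, mul_one, abs_of_pos (det_id_add_pos _)]
    rw [norm_smul, Real.norm_eq_abs]
    exact (mul_le_mul_of_nonneg_left (norm_fderiv_le_of_lipschitz ℝ hv) (abs_nonneg t)).trans_lt ht
  have hμ : μ (Metric.ball 0 (Real.sqrt (1 + t ^ 2)) \ {0}) =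
      μ (Metric.ball 0 (Real.sqrt (1 + t ^ 2))) := measure_sdiff_null (measure_singleton 0)
  constructor
  · have := (integrableOn_image_iff_integrableOn_abs_det_fderiv_smul μ hs hf hinj
      (fun _ => (1 : ℝ))).1 (by
        rw [image_add_smul_ball hv hn ho ht]
        refine integrableOn_const ?_
        rw [hμ]
        exact measure_ball_lt_top.ne)
    simpa only [habs] using this
  · have := integral_image_eq_integral_abs_det_fderiv_smul μ hs hf hinj (fun _ => (1 : ℝ))
    simp only [habs] at this
    rw [← this, image_add_smul_ball hv hn ho ht, setIntegral_const, smul_eq_mul, mul_one,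
      measureReal_def, hμ, Measure.addHaar_ball μ 0 (Real.sqrt_nonneg _), ENNReal.toReal_mul,
      ENNReal.toReal_ofReal (by positivity), measureReal_def]

open MeasureTheory Polynomial in
/-- There is no smooth field of unit tangent vectors on an even-dimensional sphere. -/
theorem no_unit_tangent_field (hodd : Odd (Module.finrank ℝ E)) {V : E → E}
    (hV : IsSmoothOnSubset V (Metric.sphere 0 1)) (h1 : ∀ s ∈ Metric.sphere (0 : E) 1, ‖V s‖ = 1)
    (ho : ∀ s ∈ Metric.sphere (0 : E) 1, inner ℝ s (V s) = 0) : False := by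
  borelize E
  have : Nontrivial E := Module.nontrivial_of_finrank_pos (R := ℝ) hodd.pos
  let μ : Measure E := Measure.addHaar
  obtain ⟨K₀, hK₀⟩ := exists_lipschitzOnWith_of_isSmoothOnSubset (isCompact_sphere 0 1) hV
  obtain ⟨K, hK, hv⟩ : ∃ K : NNReal, 0 < K ∧ LipschitzWith K (homogeneousExtension V) :=
    ⟨_, by positivity, lipschitzWith_homogeneousExtension hK₀ h1⟩
  set v := homogeneousExtension V
  set n := Module.finrank ℝ E
  set D := fun (t : ℝ) x => (ContinuousLinearMap.id ℝ E + t • fderiv ℝ v x).det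
  set B := Metric.ball (0 : E) 1 \ {0}
  have hI : ∀ t : ℝ, |t| * K < 1 → IntegrableOn (D t) B μ ∧ ∫ x in B, D t x ∂μ =
      Real.sqrt (1 + t ^ 2) ^ n * μ.real (Metric.ball 0 1) := fun t ht =>
    integral_det_id_add_smul μ hv (norm_homogeneousExtension h1) (inner_homogeneousExtension ho)
      (fun x hx => differentiableAt_homogeneousExtension hV hx) ht
  -- nodes of interpolation
  let τ : ℕ → ℝ := fun j => (K : ℝ)⁻¹ * ((j : ℝ) + 2)⁻¹
  have hτ : ∀ j, |τ j| * K < 1 := fun j => by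
    have hK' : (0 : ℝ) < K := hK
    rw [abs_of_pos (by positivity)]
    have : (K : ℝ)⁻¹ * ((j : ℝ) + 2)⁻¹ * K = ((j : ℝ) + 2)⁻¹ := by field_simp
    rw [this]
    exact inv_lt_one_of_one_lt₀ (by linarith [Nat.cast_nonneg (α := ℝ) j])
  have hτi : Function.Injective τ := fun i j hij => by
    have hK' : (K : ℝ)⁻¹ ≠ 0 := inv_ne_zero (NNReal.coe_ne_zero.2 hK.ne')
    have := inv_injective (mul_left_cancel₀ hK' hij)
    exact_mod_cast add_right_cancel this
  let ℓ := Lagrange.basis (Finset.range (n + 1)) τ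
  let q : ℝ[X] := ∑ j ∈ Finset.range (n + 1), C (∫ x in B, D (τ j) x ∂μ) * ℓ j
  -- For fixed x the determinant has degree at most n in t, so its values at n + 1 nodes determine
  -- it. These values are integrable in x, and hence the volume is a polynomial in t.
  have hD : ∀ t x, D t x = ∑ j ∈ Finset.range (n + 1), D (τ j) x * (ℓ j).eval t := fun t x => by
    obtain ⟨p, hp, hpe⟩ := exists_polynomial_eval_eq_det (fderiv ℝ v x)
    have h2 := Lagrange.eq_interpolate_of_eval_eq (f := p) (s := Finset.range (n + 1)) (v := τ)
      (r := fun j => D (τ j) x) hτi.injOn (by rw [Finset.card_range]; exact hp)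
      (fun j _ => hpe (τ j))
    have h3 := congrArg (eval t) h2
    rw [hpe, Lagrange.interpolate_apply, eval_finsetSum] at h3
    simpa using h3
  have hq : ∀ t : ℝ, |t| * K < 1 →
      q.eval t = Real.sqrt (1 + t ^ 2) ^ n * μ.real (Metric.ball 0 1) := fun t ht => by
    rw [← (hI t ht).2]
    simp only [hD t, q, eval_finsetSum, eval_mul, eval_C]
    rw [integral_finsetSum _ fun j _ => ((hI _ (hτ j)).1.mul_const _)]
    simp only [integral_mul_const]
  have hball : μ.real (Metric.ball 0 1) ≠ 0 := by
    rw [measureReal_def]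
    exact ENNReal.toReal_ne_zero.2
      ⟨(Metric.measure_ball_pos μ 0 one_pos).ne', measure_ball_lt_top.ne⟩
  refine sq_ne_C_mul_one_add_X_sq_pow hodd (pow_ne_zero 2 hball) q
    (eq_of_infinite_eval_eq _ _ ((Set.infinite_range_of_injective hτi).mono ?_))
  rintro _ ⟨j, rfl⟩
  simp only [Set.mem_ofPred_eq, eval_pow, eval_mul, eval_C, eval_add, eval_one, eval_X, hq _ (hτ j)]
  rw [mul_pow, ← pow_mul, mul_comm _ 2, pow_mul, Real.sq_sqrt (by positivity)]
  ring

/-- The hairy ball theorem: a smooth tangent field on an even-dimensional sphere has a zero. -/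
theorem hairy_ball (hodd : Odd (Module.finrank ℝ E)) {V : E → E}
    (hV : IsSmoothOnSubset V (Metric.sphere 0 1))
    (ho : ∀ s ∈ Metric.sphere (0 : E) 1, inner ℝ s (V s) = 0) :
    ∃ s ∈ Metric.sphere (0 : E) 1, V s = 0 := by
  by_contra! hne
  refine no_unit_tangent_field hodd (V := fun s => ‖V s‖⁻¹ • V s) (fun s hs => ?_)
    (fun s hs => by simp [norm_smul, norm_ne_zero_iff.2 (hne s hs)])
    (fun s hs => by rw [inner_smul_right, ho s hs, mul_zero])
  obtain ⟨U, hU, hsU, h, hh, heq⟩ := hV s hs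
  refine ⟨U ∩ h ⁻¹' {0}ᶜ, hh.continuousOn.isOpen_inter_preimage hU isOpen_compl_singleton,
    ⟨hsU, fun h0 => hne s hs ((heq ⟨hs, hsU⟩).trans h0)⟩, fun x => ‖h x‖⁻¹ • h x, ?_, ?_⟩
  · have hh' := hh.mono (Set.inter_subset_left (t := h ⁻¹' {0}ᶜ))
    exact ((hh'.norm ℝ fun x hx => hx.2).inv fun x hx => norm_ne_zero_iff.2 hx.2).smul hh'
  · rintro x ⟨hx, hxU, -⟩
    simp only [heq ⟨hx, hxU⟩]

end HairyBall

/-! ### Tangent spaces -/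

section TangentSpace

variable {E : Type*} [NormedAddCommGroup E] [InnerProductSpace ℝ E]

theorem exists_curve_of_mem_tangentSpaceAt {M : Set E} {p v : E} (hv : v ∈ tangentSpaceAt M p) :
    ∃ γ : ℝ → E, ContDiffAt ℝ ∞ γ 0 ∧ γ 0 = p ∧ HasDerivAt γ v 0 ∧
      ∀ᶠ t in 𝓝 (0 : ℝ), γ t ∈ M := by
  obtain ⟨γ, hγ, h0, rfl, hM⟩ := hv
  exact ⟨γ, hγ, h0, (hγ.differentiableAt (by simp)).hasDerivAt, hM⟩

theorem fderiv_mem_tangentSpaceAt {M N : Set E} {p v : E} {f : E → E} (hf : ContDiffAt ℝ ∞ f p)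
    (hMN : ∀ᶠ q in 𝓝 p, q ∈ M → f q ∈ N) (hv : v ∈ tangentSpaceAt M p) :
    fderiv ℝ f p v ∈ tangentSpaceAt N (f p) := by
  obtain ⟨γ, hγ, rfl, hd, hM⟩ := exists_curve_of_mem_tangentSpaceAt hv
  refine ⟨f ∘ γ, hf.comp 0 hγ, rfl,
    ((hf.differentiableAt (by simp)).hasFDerivAt.comp_hasDerivAt 0 hd).deriv, ?_⟩
  filter_upwards [hM, hγ.continuousAt.eventually hMN] with t h1 h2 using h2 h1

/-- A curve in M sees only values on M. So the differential of a map defined on M, applied to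
tangent vectors, does not depend on the local extension. -/
theorem fderiv_apply_eq_of_mem_tangentSpaceAt {F : Type*} [NormedAddCommGroup F] [NormedSpace ℝ F]
    {M : Set E} {p v : E} {f h : E → F} (hf : DifferentiableAt ℝ f p) (hh : DifferentiableAt ℝ h p)
    (heq : ∀ᶠ q in 𝓝 p, q ∈ M → f q = h q) (hv : v ∈ tangentSpaceAt M p) :
    fderiv ℝ f p v = fderiv ℝ h p v := by
  obtain ⟨γ, hγ, rfl, hd, hM⟩ := exists_curve_of_mem_tangentSpaceAt hv
  have h1 := hf.hasFDerivAt.comp_hasDerivAt 0 hd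
  have h2 := hh.hasFDerivAt.comp_hasDerivAt 0 hd
  refine h1.unique (h2.congr_of_eventuallyEq ?_)
  filter_upwards [hM, hγ.continuousAt.eventually heq] with t h1 h2 using h2 h1

theorem inner_eq_zero_of_mem_tangentSpaceAt_sphere {s v : E}
    (hv : v ∈ tangentSpaceAt (Metric.sphere (0 : E) 1) s) : inner ℝ s v = 0 := by
  have hd : HasFDerivAt (fun x : E => ‖x‖ ^ 2) (2 • innerSL ℝ s) s := hasStrictFDerivAt_norm_sq s
    |>.hasFDerivAt
  have := fderiv_apply_eq_of_mem_tangentSpaceAt hd.differentiableAt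
    (differentiableAt_const (1 : ℝ)) (Filter.Eventually.of_forall fun q hq => by
      rw [mem_sphere_zero_iff_norm.1 hq, one_pow]) hv
  rw [hd.fderiv] at this
  simpa using this

/-- Near a boundary point the boundary of a smooth open set is a regular level set. -/
theorem IsSmoothOpen.exists_defining_function {D : Set E} (hD : IsSmoothOpen D) {p : E}
    (hp : p ∈ frontier D) : ∃ U : Set E, IsOpen U ∧ p ∈ U ∧ ∃ ρ : E → ℝ, ContDiffOn ℝ ∞ ρ U ∧
      (∀ q ∈ U, fderiv ℝ ρ q ≠ 0) ∧ ∀ q ∈ U, q ∈ frontier D ↔ ρ q = 0 := by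
  obtain ⟨U, hU, hpU, ρ, hρ, hne, heq⟩ := hD.2 p hp
  have hmem : ∀ q ∈ U, q ∈ D ↔ ρ q < 0 := fun q hq => by
    have := Set.ext_iff.1 heq q
    simpa [hq] using this
  refine ⟨U, hU, hpU, ρ, hρ, hne, fun q hq => ?_⟩
  have hρq : ContDiffAt ℝ ∞ ρ q := hρ.contDiffAt (hU.mem_nhds hq)
  rw [hD.1.frontier_eq]
  constructor
  · rintro ⟨hcl, hnot⟩
    rw [hmem q hq, not_lt] at hnot
    refine le_antisymm (not_lt.1 fun hpos => ?_) hnot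
    obtain ⟨y, ⟨hy1, hy2⟩, hyD⟩ := mem_closure_iff_nhds.1 hcl _
      (Filter.inter_mem (hρq.continuousAt.eventually (lt_mem_nhds hpos)) (hU.mem_nhds hq))
    exact lt_asymm hy1 ((hmem y hy2).1 hyD)
  · intro h0
    refine ⟨?_, by rw [hmem q hq, h0]; exact lt_irrefl 0⟩
    by_contra hcl
    -- otherwise `ρ` has a local minimum at `q`
    refine hne q hq (IsLocalMin.fderiv_eq_zero ?_)
    filter_upwards [isClosed_closure.isOpen_compl.mem_nhds hcl, hU.mem_nhds hq] with y hy hyU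
    rw [h0]
    exact not_lt.1 fun h => hy (subset_closure ((hmem y hyU).2 h))

/-- The tangent space of an image under a diffeomorphism. -/
theorem tangentSpaceAt_image {L R : E → E} (hL : ContDiff ℝ ∞ L) (hR : ContDiff ℝ ∞ R)
    (hRL : ∀ x, R (L x) = x) (hLR : ∀ x, L (R x) = x) (M : Set E) (p : E) :
    tangentSpaceAt (L '' M) (L p) = fderiv ℝ L p '' tangentSpaceAt M p := by
  have hd : ∀ v, fderiv ℝ L p (fderiv ℝ R (L p) v) = v := fun v => by
    have h1 := (hL.differentiable (by simp) (R (L p))).hasFDerivAt.comp (L p)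
      (hR.differentiable (by simp) (L p)).hasFDerivAt
    have h2 : L ∘ R = id := funext hLR
    rw [h2, hRL] at h1
    exact DFunLike.congr_fun (h1.unique (hasFDerivAt_id _)) v
  apply Set.Subset.antisymm
  · intro v hv
    refine ⟨fderiv ℝ R (L p) v, ?_, hd v⟩
    have := fderiv_mem_tangentSpaceAt (f := R) (N := M) hR.contDiffAt
      (Filter.Eventually.of_forall ?_) hv
    · rwa [hRL] at this
    · rintro _ ⟨x, hx, rfl⟩
      rwa [hRL]
  · rintro _ ⟨v, hv, rfl⟩
    exact fderiv_mem_tangentSpaceAt hL.contDiffAt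
      (Filter.Eventually.of_forall fun x hx => Set.mem_image_of_mem L hx) hv

variable [FiniteDimensional ℝ E]

/-- The tangent space of a regular level set is the kernel of the differential. -/
theorem tangentSpaceAt_eq_ker {M U : Set E} (hU : IsOpen U) {p : E} (hp : p ∈ U) {ρ : E → ℝ}
    (hρ : ContDiffOn ℝ ∞ ρ U) (hne : fderiv ℝ ρ p ≠ 0) (hM : ∀ q ∈ U, q ∈ M ↔ ρ q = 0)
    (hpM : p ∈ M) : tangentSpaceAt M p = {v | fderiv ℝ ρ p v = 0} := by
  have hρp : ContDiffAt ℝ ∞ ρ p := hρ.contDiffAt (hU.mem_nhds hp)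
  have hd := hρp.differentiableAt (by simp)
  ext v
  constructor
  · intro hv
    have := fderiv_apply_eq_of_mem_tangentSpaceAt hd (differentiableAt_const (0 : ℝ))
      (by filter_upwards [hU.mem_nhds hp] with q hq hqM using (hM q hq).1 hqM) hv
    simpa using this
  · intro hv
    obtain ⟨w, hw⟩ : ∃ w, fderiv ℝ ρ p w ≠ 0 := by
      by_contra! h
      exact hne (ContinuousLinearMap.ext h)
    set α := fderiv ℝ ρ p
    let u := (α w)⁻¹ • w
    have hu : α u = 1 := by simp [u, inv_mul_cancel₀ hw]
    -- a local diffeomorphism that straightens the level set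
    let Θ : E → E := fun q => q + (ρ q - α (q - p)) • u
    have hΘ : ContDiffAt ℝ ∞ Θ p := by
      have h1 : ContDiffAt ℝ ∞ (fun q => α (q - p)) p :=
        α.contDiff.contDiffAt.comp p (contDiffAt_id.sub contDiffAt_const)
      exact contDiffAt_id.add ((hρp.sub h1).smul contDiffAt_const)
    have hΘ' : HasFDerivAt Θ ((ContinuousLinearEquiv.refl ℝ E : E ≃L[ℝ] E) : E →L[ℝ] E) p := by
      have h1 : HasFDerivAt (fun q => α (q - p)) α p :=
        α.hasFDerivAt.comp p ((hasFDerivAt_id p).sub_const p)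
      have := (hasFDerivAt_id p).fun_add ((hd.hasFDerivAt.fun_sub h1).smul_const u)
      have he : ContinuousLinearMap.id ℝ E + (fderiv ℝ ρ p - α).smulRight u =
          ((ContinuousLinearEquiv.refl ℝ E : E ≃L[ℝ] E) : E →L[ℝ] E) := by
        ext x
        simp [α]
      rw [he] at this
      exact this
    have hΘp : Θ p = p := by
      have : ρ p = 0 := (hM p hp).1 hpM
      simp [Θ, this]
    have hs := hΘ.hasStrictFDerivAt' hΘ' (by simp)
    let Ψ := hΘ.localInverse hΘ' (by simp)
    have hΨ : ContDiffAt ℝ ∞ Ψ p := by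
      have := hΘ.to_localInverse hΘ' (by simp)
      rwa [hΘp] at this
    have hΨp : Ψ p = p := by
      have := hΘ.localInverse_apply_image hΘ' (by simp)
      rwa [hΘp] at this
    have hΨd : HasFDerivAt Ψ (ContinuousLinearMap.id ℝ E) p := by
      have := hs.to_localInverse.hasFDerivAt
      rwa [hΘp] at this
    have hright : ∀ᶠ y in 𝓝 p, Θ (Ψ y) = y := by
      have := hs.eventually_right_inverse
      rwa [hΘp] at this
    have hline : ContDiff ℝ ∞ fun t : ℝ => p + t • v := by fun_prop
    have hl0 : p + (0 : ℝ) • v = p := by simp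
    have hlt : Filter.Tendsto (fun t : ℝ => p + t • v) (𝓝 0) (𝓝 p) := by
      simpa using hline.continuous.tendsto 0
    have hld : HasDerivAt (fun t : ℝ => p + t • v) v 0 := by
      simpa using ((hasDerivAt_id (0 : ℝ)).smul_const v).const_add p
    refine ⟨fun t => Ψ (p + t • v), ?_, by simp [hΨp], ?_, ?_⟩
    · exact ContDiffAt.comp (0 : ℝ) (by rwa [hl0]) hline.contDiffAt
    · have h1 : HasFDerivAt Ψ (ContinuousLinearMap.id ℝ E) (p + (0 : ℝ) • v) := by rwa [hl0]
      exact (h1.comp_hasDerivAt (0 : ℝ) hld).deriv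
    · have hUΨ : ∀ᶠ y in 𝓝 p, Ψ y ∈ U := hΨ.continuousAt.eventually (by
        rw [hΨp]; exact hU.mem_nhds hp)
      filter_upwards [hlt.eventually hUΨ, hlt.eventually hright] with t h1 h2
      rw [hM _ h1]
      -- As α u = 1, the map Θ turns ρ into the affine function α(· - p), so its inverse Ψ bends the
      -- line p + tv into the level set.
      have h3 : α (Θ (Ψ (p + t • v)) - p) = ρ (Ψ (p + t • v)) := by
        simp only [Θ, map_sub, map_add, map_smul, hu, smul_eq_mul]
        ring
      rw [← h3, h2]
      have h4 : α v = 0 := hv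
      simp [h4]

end TangentSpace

/-! ### Tangent fields on hypersurfaces diffeomorphic to a sphere -/

section TangentField

variable {E : Type*} [NormedAddCommGroup E] [InnerProductSpace ℝ E] [FiniteDimensional ℝ E]

/-- A smooth tangent field on a subset diffeomorphic to an even-dimensional sphere has a zero. -/
theorem exists_zero_of_areDiffeomorphic_sphere (hodd : Odd (Module.finrank ℝ E)) {M : Set E}
    (hM : AreDiffeomorphic M (Metric.sphere (0 : E) 1)) {W : E → E} (hW : IsSmoothOnSubset W M)
    (hT : ∀ y ∈ M, W y ∈ tangentSpaceAt M y) : ∃ y ∈ M, W y = 0 := by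
  obtain ⟨f, h, hf, hh, hinv, hfs, hhs⟩ := hM
  by_contra! hne
  -- the push-forward of `W`
  have huniq : ∀ y ∈ M, ∀ U₁ U₂ : Set E, IsOpen U₁ → IsOpen U₂ → y ∈ U₁ → y ∈ U₂ → ∀ f₁ f₂ : E → E,
      ContDiffOn ℝ ∞ f₁ U₁ → ContDiffOn ℝ ∞ f₂ U₂ → Set.EqOn f f₁ (M ∩ U₁) →
      Set.EqOn f f₂ (M ∩ U₂) → fderiv ℝ f₁ y (W y) = fderiv ℝ f₂ y (W y) := by
    intro y hy U₁ U₂ hU₁ hU₂ h₁ h₂ f₁ f₂ hf₁ hf₂ he₁ he₂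
    refine fderiv_apply_eq_of_mem_tangentSpaceAt
      ((hf₁.contDiffAt (hU₁.mem_nhds h₁)).differentiableAt (by simp))
      ((hf₂.contDiffAt (hU₂.mem_nhds h₂)).differentiableAt (by simp)) ?_ (hT y hy)
    filter_upwards [hU₁.mem_nhds h₁, hU₂.mem_nhds h₂] with q hq₁ hq₂ hqM
    rw [← he₁ ⟨hqM, hq₁⟩, ← he₂ ⟨hqM, hq₂⟩]
  choose! U hU hyU F hF heF using hfs
  -- The extension `F (h s)` changes with s; `huniq` allows a single one to be used near a given
  -- point, which gives smoothness.
  let V : E → E := fun s => fderiv ℝ (F (h s)) (h s) (W (h s))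
  have hV : IsSmoothOnSubset V (Metric.sphere 0 1) := fun s hs => by
    obtain ⟨O, hO, hsO, H, hH, heH⟩ := hhs s hs
    have hy := hh hs
    obtain ⟨O', hO', hyO', w, hw, hew⟩ := hW _ hy
    have hHs : H s = h s := (heH ⟨hs, hsO⟩).symm
    refine ⟨O ∩ H ⁻¹' (U (h s) ∩ O'), hH.continuousOn.isOpen_inter_preimage hO
      ((hU _ hy).inter hO'), ⟨hsO, ?_⟩, fun x => fderiv ℝ (F (h s)) (H x) (w (H x)), ?_, ?_⟩
    · rw [Set.mem_preimage, hHs]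
      exact ⟨hyU _ hy, hyO'⟩
    · have hH' := hH.mono (Set.inter_subset_left (t := H ⁻¹' (U (h s) ∩ O')))
      have h1 : ContDiffOn ℝ ∞ (fderiv ℝ (F (h s))) (U (h s)) :=
        (hF _ hy).fderiv_of_isOpen (hU _ hy) (by simp)
      exact (h1.comp hH' fun x hx => hx.2.1).clm_apply (hw.comp hH' fun x hx => hx.2.2)
    · rintro x ⟨hx, hxO, hxU, hxO'⟩
      have hHx : H x = h x := (heH ⟨hx, hxO⟩).symm
      rw [hHx] at hxU hxO'
      have hx' := hh hx
      simp only [V, hHx]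
      rw [← hew ⟨hx', hxO'⟩]
      exact huniq _ hx' _ _ (hU _ hx') (hU _ hy) (hyU _ hx') hxU _ _ (hF _ hx') (hF _ hy)
        (heF _ hx') (heF _ hy)
  have hVo : ∀ s ∈ Metric.sphere (0 : E) 1, inner ℝ s (V s) = 0 := fun s hs => by
    have hy := hh hs
    have hsF : F (h s) (h s) = s := by
      rw [← heF _ hy ⟨hy, hyU _ hy⟩, hinv.2 hs]
    have := fderiv_mem_tangentSpaceAt (f := F (h s)) (N := Metric.sphere (0 : E) 1)
      ((hF _ hy).contDiffAt ((hU _ hy).mem_nhds (hyU _ hy))) ?_ (hT _ hy)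
    · rw [hsF] at this
      exact inner_eq_zero_of_mem_tangentSpaceAt_sphere this
    · filter_upwards [(hU _ hy).mem_nhds (hyU _ hy)] with q h1 hq
      rw [← heF _ hy ⟨hq, h1⟩]
      exact hf hq
  obtain ⟨s, hs, hs0⟩ := hairy_ball hodd hV hVo
  obtain ⟨O, hO, hsO, H, hH, heH⟩ := hhs s hs
  have hy := hh hs
  have hsF : F (h s) (h s) = s := by
    rw [← heF _ hy ⟨hy, hyU _ hy⟩, hinv.2 hs]
  have hHs : H s = h s := (heH ⟨hs, hsO⟩).symm
  have hFd := ((hF _ hy).contDiffAt ((hU _ hy).mem_nhds (hyU _ hy)))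
  have hHd : ContDiffAt ℝ ∞ H (F (h s) (h s)) := by
    rw [hsF]; exact hH.contDiffAt (hO.mem_nhds hsO)
  have hcomp := (hHd.differentiableAt (by simp)).hasFDerivAt.comp (h s)
    (hFd.differentiableAt (by simp)).hasFDerivAt
  -- H ∘ F is the identity on M near h s, so its differential fixes W (h s); at a zero of V it also
  -- kills this vector.
  have := fderiv_apply_eq_of_mem_tangentSpaceAt (f := H ∘ F (h s)) (h := id)
    hcomp.differentiableAt differentiableAt_id ?_ (hT _ hy)
  · rw [hcomp.fderiv, fderiv_id] at this
    refine hne _ hy ?_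
    have h1 : fderiv ℝ (F (h s)) (h s) (W (h s)) = 0 := hs0
    simpa [h1] using this.symm
  · filter_upwards [(hU _ hy).mem_nhds (hyU _ hy), hFd.continuousAt.eventually
      (show ∀ᶠ z in 𝓝 (F (h s) (h s)), z ∈ O by rw [hsF]; exact hO.mem_nhds hsO)] with q h1 h2 hq
    have h3 : F (h s) q = f q := (heF _ hy ⟨hq, h1⟩).symm
    simp only [Function.comp_apply, id]
    rw [h3] at h2 ⊢
    rw [← heH ⟨hf hq, h2⟩, hinv.1 hq]

/-- A nowhere vanishing field of normals is normal to a given hypersurface somewhere, if the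
hypersurface is diffeomorphic to an even-dimensional sphere. -/
theorem exists_tangentSpaceAt_eq (hodd : Odd (Module.finrank ℝ E)) {D : Set E}
    (hD : IsSmoothOpen D) (hS : AreDiffeomorphic (frontier D) (Metric.sphere (0 : E) 1))
    {a : E → E} (ha : ContDiff ℝ ∞ a) (ha0 : ∀ y, a y ≠ 0) :
    ∃ y ∈ frontier D, tangentSpaceAt (frontier D) y = {v | inner ℝ (a y) v = 0} := by
  -- the projection of `a` to the tangent space
  let IsProj : E → E → Prop := fun y w => w ∈ tangentSpaceAt (frontier D) y ∧
    ∀ v ∈ tangentSpaceAt (frontier D) y, inner ℝ (a y - w) v = 0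
  let G : (E →L[ℝ] ℝ) →L[ℝ] E := LinearMap.toContinuousLinearMap
    { toFun := (InnerProductSpace.toDual ℝ E).symm
      map_add' := fun x y => by simp
      map_smul' := fun c x => by simp }
  have hG : ∀ (l : E →L[ℝ] ℝ) v, inner ℝ (G l) v = l v := fun l v =>
    InnerProductSpace.toDual_symm_apply
  have hG0 : ∀ l : E →L[ℝ] ℝ, l ≠ 0 → G l ≠ 0 := fun l hl h0 => hl (by
    ext v; rw [← hG, h0]; simp)
  have hloc : ∀ p ∈ frontier D, ∃ U : Set E, IsOpen U ∧ p ∈ U ∧ ∃ b : E → E,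
      ContDiffOn ℝ ∞ b U ∧ (∀ q ∈ U, b q ≠ 0) ∧
      ∀ q ∈ frontier D ∩ U, tangentSpaceAt (frontier D) q = {v | inner ℝ (b q) v = 0} := by
    intro p hp
    obtain ⟨U, hU, hpU, ρ, hρ, hne, hfr⟩ := hD.exists_defining_function hp
    refine ⟨U, hU, hpU, fun q => G (fderiv ℝ ρ q), G.contDiff.comp_contDiffOn
      (hρ.fderiv_of_isOpen hU (by simp)), fun q hq => hG0 _ (hne q hq), fun q hq => ?_⟩
    rw [tangentSpaceAt_eq_ker hU hq.2 hρ (hne q hq.2) hfr hq.1]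
    simp only [hG]
  have hproj : ∀ (q b : E), b ≠ 0 → tangentSpaceAt (frontier D) q = {v | inner ℝ b v = 0} →
      IsProj q (a q - ((inner ℝ (a q) b) / (inner ℝ b b)) • b) := by
    intro q b hb hT
    have hbb : inner ℝ b b ≠ 0 := inner_self_ne_zero.2 hb
    refine ⟨?_, fun v hv => ?_⟩
    · rw [hT]
      change inner ℝ b _ = 0
      rw [inner_sub_right, inner_smul_right, div_mul_cancel₀ _ hbb, real_inner_comm, sub_self]
    · rw [hT] at hv
      have hv' : inner ℝ b v = 0 := hv
      rw [sub_sub_cancel, inner_smul_left, hv', mul_zero]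
  -- Two projections differ by a tangent vector that is orthogonal to itself. Hence the local
  -- formulas, written with different normals b, agree and define one smooth field.
  have huniq : ∀ q ∈ frontier D, ∀ w₁ w₂, IsProj q w₁ → IsProj q w₂ → w₁ = w₂ := by
    intro q hq w₁ w₂ h₁ h₂
    obtain ⟨U, -, hqU, b, -, -, hT⟩ := hloc q hq
    have hsub : w₁ - w₂ ∈ tangentSpaceAt (frontier D) q := by
      have h1 := h₁.1
      have h2 := h₂.1
      rw [hT q ⟨hq, hqU⟩] at h1 h2 ⊢
      change inner ℝ _ _ = 0
      rw [inner_sub_right, show inner ℝ _ _ = 0 from h1, show inner ℝ _ _ = 0 from h2, sub_self]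
    have h3 := h₁.2 _ hsub
    have h4 := h₂.2 _ hsub
    rw [← sub_eq_zero, ← inner_self_eq_zero (𝕜 := ℝ)]
    have h5 : (w₁ - w₂) = (a q - w₂) - (a q - w₁) := by abel
    nth_rewrite 1 [h5]
    rw [inner_sub_left, h3, h4, sub_zero]
  have hex : ∀ q ∈ frontier D, ∃ w, IsProj q w := fun q hq => by
    obtain ⟨U, -, hqU, b, -, hb, hT⟩ := hloc q hq
    exact ⟨_, hproj q (b q) (hb q hqU) (hT q ⟨hq, hqU⟩)⟩
  choose! W hW using hex
  have hWs : IsSmoothOnSubset W (frontier D) := fun p hp => by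
    obtain ⟨U, hU, hpU, b, hbs, hb, hT⟩ := hloc p hp
    refine ⟨U, hU, hpU, fun q => a q - ((inner ℝ (a q) (b q)) / (inner ℝ (b q) (b q))) • b q, ?_,
      fun q hq => huniq q hq.1 _ _ (hW q hq.1) (hproj q (b q) (hb q hq.2) (hT q hq))⟩
    exact ha.contDiffOn.sub (((ha.contDiffOn.inner ℝ hbs).div (hbs.inner ℝ hbs)
      fun q hq => inner_self_ne_zero.2 (hb q hq)).smul hbs)
  obtain ⟨y, hy, hy0⟩ := exists_zero_of_areDiffeomorphic_sphere hodd hS hWs fun y hy => (hW y hy).1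
  refine ⟨y, hy, ?_⟩
  obtain ⟨U, -, hyU, b, -, hb, hT⟩ := hloc y hy
  have hTy := hT y ⟨hy, hyU⟩
  have h1 := huniq y hy _ _ (hproj y (b y) (hb y hyU) hTy) (hW y hy)
  rw [hy0, sub_eq_zero] at h1
  rw [hTy]
  obtain ⟨c, hc⟩ : ∃ c : ℝ, a y = c • b y := ⟨_, h1⟩
  have hc0 : c ≠ 0 := fun h0 => ha0 y (by rw [hc, h0, zero_smul])
  ext v
  simp only [Set.mem_ofPred_eq]
  rw [hc, inner_smul_left, mul_eq_zero]
  exact ⟨Or.inr, fun h => h.resolve_left (by simpa using hc0)⟩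

end TangentField

/-! ### Tangency -/

section Tangency

variable {g : Type*} [NormedLieRing g] [EuclideanLieAlgebra g] [FiniteDimensional ℝ g] {k : ℕ}

/-- In odd dimension a smooth open set is tangent to every nonempty `T`-family. -/
theorem Stratification.isTangentTo (S : Stratification g k) (hodd : Odd (Module.finrank ℝ g))
    {D : Set g} (hD : IsSmoothOpen D) {ℱ : Set (Set g)} (hℱ : S.IsTFamily ℱ) (hne : ℱ.Nonempty) :
    IsTangentTo D ℱ := by
  intro x hx
  obtain ⟨F, hF⟩ := hne
  obtain ⟨U, hU, hxU, ρ, hρ, hρ0, hfr⟩ := hD.exists_defining_function hx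
  rw [tangentSpaceAt_eq_ker hU hxU hρ (hρ0 x hxU) hfr hx]
  have hα0 := hρ0 x hxU
  set α := fderiv ℝ ρ x
  obtain ⟨R, hR, hLR, hRL⟩ := S.exists_leftDivision
  obtain ⟨d, hd, hdmul⟩ := S.exists_rightDivision
  -- the translation that takes `y` to `x`
  let z : g → g := fun y => d (y, x)
  have hz : ContDiff ℝ ∞ z := hd.comp (contDiff_id.prodMk contDiff_const)
  have hmul : ∀ w : g, ContDiff ℝ ∞ (mul k w) := fun w =>
    (contDiff_mul k).comp (contDiff_const.prodMk contDiff_id)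
  have hRw : ∀ w : g, ContDiff ℝ ∞ fun y => R (w, y) := fun w =>
    hR.comp (contDiff_const.prodMk contDiff_id)
  have hsurj : ∀ w y : g, Function.Surjective (fderiv ℝ (mul k w) y) := fun w y v => by
    have h1 := ((hmul w).differentiable (by simp) (R (w, mul k w y))).hasFDerivAt.comp (mul k w y)
      ((hRw w).differentiable (by simp) (mul k w y)).hasFDerivAt
    have h2 : mul k w ∘ (fun y => R (w, y)) = id := funext (hLR w)
    rw [h2, hRL] at h1
    exact ⟨_, DFunLike.congr_fun (h1.unique (hasFDerivAt_id _)) v⟩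
  -- The translating element z y is frozen while differentiating; the map y ↦ z(y)y itself is
  -- constant.
  let A : g → g →L[ℝ] g := fun y => fderiv ℝ (mul k (z y)) y
  have hA : ContDiff ℝ ∞ A := by
    refine ContDiff.fderiv (n := ∞) (m := ∞) (f := fun y => mul k (z y)) ?_ contDiff_id (by simp)
    exact (contDiff_mul k).comp ((hz.comp contDiff_fst).prodMk contDiff_snd)
  let G : (g →L[ℝ] ℝ) →L[ℝ] g := LinearMap.toContinuousLinearMap
    { toFun := (InnerProductSpace.toDual ℝ g).symm
      map_add' := fun x y => by simp
      map_smul' := fun c x => by simp }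
  have hG : ∀ (l : g →L[ℝ] ℝ) v, inner ℝ (G l) v = l v := fun l v =>
    InnerProductSpace.toDual_symm_apply
  obtain ⟨y, hy, hTy⟩ := exists_tangentSpaceAt_eq hodd (hℱ.isSmoothOpen F hF)
    (hℱ.diffeomorphic F hF) (a := fun y => G (α.comp (A y)))
    (G.contDiff.comp (contDiff_const.clm_comp hA)) fun y h0 => by
      refine hα0 (ContinuousLinearMap.ext fun v => ?_)
      obtain ⟨u, rfl⟩ := hsurj (z y) y v
      have := hG (α.comp (A y)) u
      rw [h0, inner_zero_left] at this
      exact this.symm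
  have hxy : mul k (z y) y = x := hdmul y x
  have himage : frontier (mul k (z y) '' F) = mul k (z y) '' frontier F :=
    ((Homeomorph.mk ⟨mul k (z y), fun w => R (z y, w), hRL (z y), hLR (z y)⟩
      (hmul _).continuous (hRw _).continuous).image_frontier F).symm
  refine ⟨_, hℱ.left_invariant (z y) F hF, ?_, ?_⟩
  · rw [himage]
    exact ⟨y, hy, hxy⟩
  · rw [himage, ← hxy, tangentSpaceAt_image (hmul (z y)) (hRw (z y)) (hRL (z y)) (hLR (z y)), hTy]
    ext w
    simp only [hG, Set.mem_image, Set.mem_ofPred_eq]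
    constructor
    · rintro ⟨v, hv, rfl⟩
      exact hv
    · intro hw
      obtain ⟨v, rfl⟩ := hsurj (z y) y w
      exact ⟨v, hw, rfl⟩

end Tangency

/-! ### Supporting hyperplanes -/

/-- With interior points, Hahn–Banach separates x₀ from the interior, whose closure contains D.
Otherwise D lies in a proper affine subspace, and a functional constant on it serves. -/
theorem exists_supporting_functional {E : Type*} [NormedAddCommGroup E] [NormedSpace ℝ E]
    [FiniteDimensional ℝ E] {D : Set E} (hD : Convex ℝ D) {x₀ : E} (hx₀ : x₀ ∈ frontier D) :
    ∃ l : E →L[ℝ] ℝ, l ≠ 0 ∧ ∀ y ∈ D, l y ≤ l x₀ := by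
  by_cases hint : (interior D).Nonempty
  · obtain ⟨l, hl⟩ := geometric_hahn_banach_open_point hD.interior isOpen_interior hx₀.2
    obtain ⟨p, hp⟩ := hint
    refine ⟨l, fun h0 => by simpa [h0] using hl p hp, fun y hy => ?_⟩
    have hcl : y ∈ closure (interior D) := by
      rw [hD.closure_interior_eq_closure_of_nonempty_interior ⟨p, hp⟩]
      exact subset_closure hy
    exact closure_minimal (fun y hy => (hl y hy).le) (isClosed_le l.continuous continuous_const) hcl
  · have hne : affineSpan ℝ D ≠ ⊤ := fun h => hint (hD.interior_nonempty_iff_affineSpan_eq_top.2 h)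
    have hDn : D.Nonempty := closure_nonempty_iff.1 ⟨x₀, hx₀.1⟩
    have hdir : (affineSpan ℝ D).direction ≠ ⊤ := fun h => hne
      ((AffineSubspace.direction_eq_top_iff_of_nonempty
        ((affineSpan_nonempty ℝ).2 hDn)).1 h)
    obtain ⟨v, -, hv⟩ := SetLike.exists_of_lt (lt_top_iff_ne_top.2 hdir)
    obtain ⟨l, hlv, hl⟩ := Submodule.exists_le_ker_of_notMem hv
    refine ⟨LinearMap.toContinuousLinearMap l, fun h0 => hlv ?_, fun y hy => ?_⟩
    · exact DFunLike.congr_fun h0 v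
    · have hD' : D ⊆ {x | LinearMap.toContinuousLinearMap l x = l y} := fun x hx => by
        have := hl (AffineSubspace.vsub_mem_direction (subset_affineSpan ℝ D hx)
          (subset_affineSpan ℝ D hy))
        rw [LinearMap.mem_ker, vsub_eq_sub, map_sub, sub_eq_zero] at this
        exact this
      exact (closure_minimal hD' (isClosed_eq (ContinuousLinearMap.continuous _)
        continuous_const) hx₀.1).ge

/-! ### Tangent points on gauge spheres -/

section GaugeSphere

variable {H₁ H₂ : Type*} [NormedAddCommGroup H₁] [InnerProductSpace ℝ H₁]
  [NormedAddCommGroup H₂] [InnerProductSpace ℝ H₂]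

/-- In the inner product with x the skew part drops out; then Cauchy–Schwarz. -/
theorem mul_norm_le_of_skew {J : H₁ →L[ℝ] H₁} (hJ : ∀ x, inner ℝ (J x) x = 0) (μ : ℝ) (x : H₁) :
    μ * ‖x‖ ≤ ‖μ • x - J x‖ := by
  rcases eq_or_ne x 0 with rfl | hx
  · simp
  have h1 : inner ℝ (μ • x - J x) x = μ * ‖x‖ ^ 2 := by
    rw [inner_sub_left, inner_smul_left, hJ, real_inner_self_eq_norm_sq, sub_zero]; rfl
  have h2 := real_inner_le_norm (μ • x - J x) x
  have h3 : 0 < ‖x‖ := norm_pos_iff.2 hx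
  rw [h1] at h2
  nlinarith

/-- The gauge ball lies strictly inside of the half-space with inner normal `-(c|z₁|²z₁, 8cz₂)`. -/
theorem gauge_inner_lt {z₁ w₁ : H₁} {z₂ w₂ : H₂}
    (h : ‖w₁‖ ^ 4 + 16 * ‖w₂‖ ^ 2 < ‖z₁‖ ^ 4 + 16 * ‖z₂‖ ^ 2) :
    ‖z₁‖ ^ 2 * inner ℝ z₁ (w₁ - z₁) + 8 * inner ℝ z₂ (w₂ - z₂) < 0 := by
  rw [inner_sub_right, inner_sub_right, real_inner_self_eq_norm_sq, real_inner_self_eq_norm_sq]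
  have h1 := real_inner_le_norm z₁ w₁
  have h2 := real_inner_le_norm z₂ w₂
  have h3 := mul_le_mul_of_nonneg_left h1 (sq_nonneg ‖z₁‖)
  have h4 : 2 * (‖z₂‖ * ‖w₂‖) ≤ ‖z₂‖ ^ 2 + ‖w₂‖ ^ 2 := by nlinarith [sq_nonneg (‖z₂‖ - ‖w₂‖)]
  -- Young's inequality, from 3a⁴ - 4a³b + b⁴ = (a - b)²(2a² + (a + b)²).
  have h5 : 4 * (‖z₁‖ ^ 2 * (‖z₁‖ * ‖w₁‖)) ≤ 3 * ‖z₁‖ ^ 4 + ‖w₁‖ ^ 4 := by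
    nlinarith [mul_nonneg (sq_nonneg (‖z₁‖ - ‖w₁‖))
      (add_nonneg (mul_nonneg zero_le_two (sq_nonneg ‖z₁‖)) (sq_nonneg (‖z₁‖ + ‖w₁‖)))]
  nlinarith

variable [FiniteDimensional ℝ H₁]

theorem isUnit_smul_one_sub_of_skew {J : H₁ →L[ℝ] H₁} (hJ : ∀ x, inner ℝ (J x) x = 0) {μ : ℝ}
    (hμ : 0 < μ) : IsUnit (μ • (1 : H₁ →L[ℝ] H₁) - J) := by
  have hinj : Function.Injective (μ • (1 : H₁ →L[ℝ] H₁) - J) := by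
    rw [injective_iff_map_eq_zero]
    intro x hx
    have h1 := mul_norm_le_of_skew hJ μ x
    have h2 : μ • x - J x = 0 := hx
    rw [h2, norm_zero] at h1
    exact norm_le_zero_iff.1 (nonpos_of_mul_nonpos_right h1 hμ)
  rw [ContinuousLinearMap.isUnit_iff_bijective]
  exact ⟨hinj, (LinearMap.injective_iff_surjective
    (f := ((μ • (1 : H₁ →L[ℝ] H₁) - J : H₁ →L[ℝ] H₁) : H₁ →ₗ[ℝ] H₁))).1 hinj⟩

/-- The point of the gauge sphere of radius `r` at which `(a₁ - J z₁, a₂)` is an inner normal. -/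
theorem exists_tangent_point_gaugeSphere {J : H₁ →L[ℝ] H₁} (hJ : ∀ x, inner ℝ (J x) x = 0)
    {a₁ : H₁} {a₂ : H₂} (hJ₀ : a₂ = 0 → J = 0) (ha : a₁ ≠ 0 ∨ a₂ ≠ 0) {r : ℝ} (hr : 0 < r) :
    ∃ (z₁ : H₁) (z₂ : H₂) (c : ℝ), 0 < c ∧ ‖z₁‖ ^ 4 + 16 * ‖z₂‖ ^ 2 = r ^ 4 ∧
      a₁ - J z₁ = -((c * ‖z₁‖ ^ 2) • z₁) ∧ a₂ = -((8 * c) • z₂) := by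
  by_cases h₂ : a₂ = 0
  · have h₁ : a₁ ≠ 0 := ha.resolve_right (not_not.2 h₂)
    have hn : 0 < ‖a₁‖ := norm_pos_iff.2 h₁
    have hz : ‖(-((r / ‖a₁‖) • a₁))‖ = r := by
      rw [norm_neg, norm_smul, Real.norm_of_nonneg (by positivity), div_mul_cancel₀ _ hn.ne']
    refine ⟨-((r / ‖a₁‖) • a₁), 0, ‖a₁‖ / r ^ 3, by positivity, by simp [hz], ?_, by simp [h₂]⟩
    rw [hJ₀ h₂, hz, smul_neg, neg_neg, smul_smul]
    have : ‖a₁‖ / r ^ 3 * r ^ 2 * (r / ‖a₁‖) = 1 := by field_simp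
    rw [this]
    simp
  have hn₂ : 0 < ‖a₂‖ := norm_pos_iff.2 h₂
  by_cases h₁ : a₁ = 0
  · have hz : ‖(-((r ^ 2 / (4 * ‖a₂‖)) • a₂))‖ = r ^ 2 / 4 := by
      rw [norm_neg, norm_smul, Real.norm_of_nonneg (by positivity)]
      field_simp
    refine ⟨0, -((r ^ 2 / (4 * ‖a₂‖)) • a₂), ‖a₂‖ / (2 * r ^ 2), by positivity, ?_,
      by simp [h₁], ?_⟩
    · rw [hz, norm_zero]; ring
    · rw [smul_neg, neg_neg, smul_smul]
      have : 8 * (‖a₂‖ / (2 * r ^ 2)) * (r ^ 2 / (4 * ‖a₂‖)) = 1 := by field_simp; norm_num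
      rw [this, one_smul]
  have hn₁ : 0 < ‖a₁‖ := norm_pos_iff.2 h₁
  -- With μ = c|z₁|² the first equation reads (μ - J)z₁ = -a₁, which has a unique solution for every
  -- μ > 0. Then c = μ/|z₁|², and the second equation determines z₂.
  let Z : ℝ → H₁ := fun μ => -(Ring.inverse (μ • (1 : H₁ →L[ℝ] H₁) - J) a₁)
  have hZ : ∀ μ, 0 < μ → μ • Z μ - J (Z μ) = -a₁ := fun μ hμ => by
    have h1 := Ring.mul_inverse_cancel _ (isUnit_smul_one_sub_of_skew hJ hμ)
    have h2 : (μ • (1 : H₁ →L[ℝ] H₁) - J) (Ring.inverse (μ • (1 : H₁ →L[ℝ] H₁) - J) a₁) = a₁ :=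
      DFunLike.congr_fun h1 a₁
    have h3 : (μ • (1 : H₁ →L[ℝ] H₁) - J) (Z μ) = -a₁ := by simp only [Z, map_neg, h2]
    exact h3
  have hZc : ContinuousOn Z (Set.Ioi 0) := fun μ hμ => by
    obtain ⟨u, hu⟩ := isUnit_smul_one_sub_of_skew hJ hμ
    have h1 := NormedRing.inverse_continuousAt u
    rw [hu] at h1
    have h2 : ContinuousAt (fun μ : ℝ => μ • (1 : H₁ →L[ℝ] H₁) - J) μ := by fun_prop
    have h3 : ContinuousAt (fun μ : ℝ => Ring.inverse (μ • (1 : H₁ →L[ℝ] H₁) - J)) μ :=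
      ContinuousAt.comp (f := fun μ : ℝ => μ • (1 : H₁ →L[ℝ] H₁) - J) h1 h2
    exact (h3.clm_apply continuousAt_const).neg.continuousWithinAt
  clear_value Z
  have hub : ∀ μ, 0 < μ → μ * ‖Z μ‖ ≤ ‖a₁‖ := fun μ hμ => by
    have := mul_norm_le_of_skew hJ μ (Z μ)
    rwa [hZ μ hμ, norm_neg] at this
  have hlb : ∀ μ, 0 < μ → ‖a₁‖ ≤ (μ + ‖J‖) * ‖Z μ‖ := fun μ hμ => by
    have h1 := norm_sub_le (μ • Z μ) (J (Z μ))
    rw [hZ μ hμ, norm_neg, norm_smul, Real.norm_of_nonneg hμ.le] at h1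
    have h2 := J.le_opNorm (Z μ)
    linarith
  -- The fourth power of the gauge of the resulting point. It blows up as μ → 0, where |Z| stays
  -- bounded below, and tends to 0 as μ → ∞, where |Z| ≤ |a₁|/μ.
  let h : ℝ → ℝ := fun μ => ‖Z μ‖ ^ 4 * (1 + ‖a₂‖ ^ 2 / (4 * μ ^ 2))
  have hc : ContinuousOn h (Set.Ioi 0) := by
    refine (hZc.norm.pow 4).mul (continuousOn_const.add (continuousOn_const.div (by fun_prop) ?_))
    intro μ hμ
    have : (0 : ℝ) < μ := hμ
    positivity
  obtain ⟨μ₀, hμ₀, hlarge⟩ : ∃ μ, 0 < μ ∧ r ^ 4 ≤ h μ := by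
    let m := ‖a₁‖ / (1 + ‖J‖)
    have hm : 0 < m := by positivity
    let μ := min 1 (m ^ 2 * ‖a₂‖ / (2 * r ^ 2))
    have hμ : 0 < μ := lt_min one_pos (by positivity)
    have hmZ : m ≤ ‖Z μ‖ := by
      rw [div_le_iff₀ (by positivity)]
      have := hlb μ hμ
      have h1 : μ ≤ 1 := min_le_left _ _
      nlinarith [norm_nonneg (Z μ), norm_nonneg J]
    have hμ2 : 2 * r ^ 2 * μ ≤ m ^ 2 * ‖a₂‖ := by
      have := min_le_right 1 (m ^ 2 * ‖a₂‖ / (2 * r ^ 2))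
      rw [le_div_iff₀ (by positivity)] at this
      linarith
    refine ⟨μ, hμ, ?_⟩
    have h1 : r ^ 4 ≤ m ^ 4 * (‖a₂‖ ^ 2 / (4 * μ ^ 2)) := by
      rw [mul_div_assoc', le_div_iff₀ (by positivity)]
      have := pow_le_pow_left₀ (by positivity) hμ2 2
      nlinarith
    refine h1.trans (mul_le_mul (pow_le_pow_left₀ hm.le hmZ 4) ?_ (by positivity) (by positivity))
    linarith
  obtain ⟨μ₁, hμ₁, hsmall⟩ : ∃ μ, 0 < μ ∧ h μ ≤ r ^ 4 := by
    let C := ‖a₁‖ ^ 4 * (1 + ‖a₂‖ ^ 2 / 4)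
    let μ := max 1 (C / r ^ 4)
    have h1 : 1 ≤ μ := le_max_left _ _
    have hμ : 0 < μ := one_pos.trans_le h1
    have hC : C ≤ μ * r ^ 4 := (div_le_iff₀ (by positivity)).1 (le_max_right 1 (C / r ^ 4))
    refine ⟨μ, hμ, ?_⟩
    have h2 : ‖Z μ‖ ≤ ‖a₁‖ / μ := by
      rw [le_div_iff₀ hμ, mul_comm]; exact hub μ hμ
    have h3 : ‖a₂‖ ^ 2 / (4 * μ ^ 2) ≤ ‖a₂‖ ^ 2 / 4 :=
      div_le_div_of_nonneg_left (by positivity) (by norm_num) (by nlinarith)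
    have h4 : ‖Z μ‖ ^ 4 ≤ ‖a₁‖ ^ 4 / μ := by
      refine (pow_le_pow_left₀ (norm_nonneg _) h2 4).trans ?_
      rw [div_pow]
      exact div_le_div_of_nonneg_left (by positivity) hμ (le_self_pow₀ h1 (by norm_num))
    calc h μ ≤ ‖a₁‖ ^ 4 / μ * (1 + ‖a₂‖ ^ 2 / 4) :=
          mul_le_mul h4 (by linarith) (by positivity) (by positivity)
      _ = C / μ := by simp only [C]; ring
      _ ≤ r ^ 4 := by rw [div_le_iff₀ hμ]; linarith
  obtain ⟨μ, hμ, hhμ⟩ := isPreconnected_Ioi.intermediate_value hμ₁ hμ₀ hc ⟨hsmall, hlarge⟩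
  have hμ' : 0 < μ := hμ
  have hZ0 : 0 < ‖Z μ‖ := by
    rw [norm_pos_iff]
    intro h0
    have := hZ μ hμ
    rw [h0] at this
    simp at this
    exact h₁ this
  refine ⟨Z μ, -((‖Z μ‖ ^ 2 / (8 * μ)) • a₂), μ / ‖Z μ‖ ^ 2, by positivity, ?_, ?_, ?_⟩
  · rw [← hhμ, norm_neg, norm_smul, Real.norm_of_nonneg (by positivity)]
    simp only [h]
    field_simp
    ring
  · rw [div_mul_cancel₀ _ (by positivity),
      show a₁ = -(μ • Z μ - J (Z μ)) by rw [hZ μ hμ, neg_neg]]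
    abel
  · rw [smul_neg, neg_neg, smul_smul]
    have : 8 * (μ / ‖Z μ‖ ^ 2) * (‖Z μ‖ ^ 2 / (8 * μ)) = 1 := by field_simp
    rw [this, one_smul]

end GaugeSphere

/-! ### Step two -/

namespace Stratification

section StepTwo

variable {g : Type*} [NormedLieRing g] [EuclideanLieAlgebra g]

/-- The projection to a layer. -/
noncomputable def proj {k : ℕ} (S : Stratification g k) (j : ℕ) : g →ₗ[ℝ] S.layer j :=
  DirectSum.component ℝ ℕ (fun i => S.layer i) j ∘ₗ
    (LinearEquiv.ofBijective (DirectSum.coeLinearMap S.layer) S.isInternal).symm.toLinearMap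

theorem component_eq_proj {k : ℕ} (S : Stratification g k) (j : ℕ) (x : g) :
    S.component j x = S.proj j x := rfl

theorem proj_of_mem {k : ℕ} (S : Stratification g k) {j : ℕ} {x : g} (hx : x ∈ S.layer j) (i : ℕ) :
    (S.proj i x : g) = if j = i then x else 0 := by
  have h1 : (LinearEquiv.ofBijective (DirectSum.coeLinearMap S.layer) S.isInternal).symm x =
      DirectSum.lof ℝ ℕ (fun i => S.layer i) j ⟨x, hx⟩ := by
    rw [LinearEquiv.symm_apply_eq]
    exact (DirectSum.coeLinearMap_lof S.layer j ⟨x, hx⟩).symm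
  simp only [proj, LinearMap.comp_apply, LinearEquiv.coe_coe, h1]
  split_ifs with h
  · subst h
    rw [DirectSum.component.lof_self]
  · rw [DirectSum.component.of, dif_neg h]
    rfl

variable (S : Stratification g 2)

theorem proj_add_proj (x : g) : (S.proj 1 x : g) + S.proj 2 x = x := by
  have hx : x ∈ ⨆ j, S.layer j := by rw [S.isInternal.submodule_iSup_eq_top]; trivial
  induction hx using Submodule.iSup_induction' with
  | zero => simp
  | add x y _ _ hx hy =>
    conv_rhs => rw [← hx, ← hy]
    simp only [map_add, Submodule.coe_add]
    abel
  | mem j x hx =>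
    rw [S.proj_of_mem hx, S.proj_of_mem hx]
    rcases Nat.lt_trichotomy j 2 with h | rfl | h
    · interval_cases j
      · rw [S.layer_zero, Submodule.mem_bot] at hx
        simp [hx]
      · simp
    · simp
    · rw [S.layer_eq_bot j h, Submodule.mem_bot] at hx
      simp [hx]

theorem lie_lie_eq_zero (S : Stratification g 2) (x y z : g) : ⁅x, ⁅y, z⁆⁆ = 0 := by
  have h1 := S.lie_mem_filtration (i := 0) (j := 0) (x := y) (y := z)
    (by simp [S.filtration_zero]) (by simp [S.filtration_zero])
  have h2 := S.lie_mem_filtration (i := 0) (x := x) (by simp [S.filtration_zero]) h1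
  rwa [S.filtration_step, Submodule.mem_bot] at h2

theorem lie_layer_two_eq_zero (x : g) {y : g} (hy : y ∈ S.layer 2) : ⁅x, y⁆ = 0 := by
  have h2 := S.lie_mem_filtration (i := 0) (x := x) (by simp [S.filtration_zero])
    (S.layer_le_filtration one_lt_two hy)
  exact (Submodule.mem_bot ℝ).1 (S.filtration_step ▸ h2)

theorem expAd_two_apply (S : Stratification g 2) (x y : g) : expAd 2 x y = y + ⁅x, y⁆ := by
  simp [expAd, Finset.sum_range_succ, pow_two, S.lie_lie_eq_zero]

theorem gauge_nonneg (x : g) : 0 ≤ S.gauge x := Real.rpow_nonneg (by positivity) _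

theorem gauge_pow_four (x : g) :
    S.gauge x ^ 4 = ‖S.proj 1 x‖ ^ 4 + 16 * ‖S.proj 2 x‖ ^ 2 := by
  have h : (0 : ℝ) ≤ ‖S.component 1 x‖ ^ 4 + 16 * ‖S.component 2 x‖ ^ 2 := by positivity
  rw [gauge, ← Real.rpow_natCast, ← Real.rpow_mul h]
  norm_num [component_eq_proj]

theorem gauge_lt_iff {x : g} {r : ℝ} (hr : 0 ≤ r) :
    S.gauge x < r ↔ ‖S.proj 1 x‖ ^ 4 + 16 * ‖S.proj 2 x‖ ^ 2 < r ^ 4 := by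
  rw [← S.gauge_pow_four, pow_lt_pow_iff_left₀ (S.gauge_nonneg x) hr (by norm_num)]

variable [FiniteDimensional ℝ g]

/-- As [y, y] = 0, the operator sends y to [x, y] and then to 0, so only m = 0 and m = 1 contribute,
with coefficients 1 and 1/2. -/
theorem mul_two (S : Stratification g 2) (x y : g) : mul 2 x y = x + y + (2⁻¹ : ℝ) • ⁅x, y⁆ := by
  have h1 : ∀ t : ℝ, (expAd 2 x * expAd 2 (t • y) - 1 : Module.End ℝ g) y = ⁅x, y⁆ := fun t => by
    simp [S.expAd_two_apply]
  have h2 : ∀ t : ℝ, (expAd 2 x * expAd 2 (t • y) - 1 : Module.End ℝ g) ⁅x, y⁆ = 0 := fun t => by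
    simp [S.expAd_two_apply, S.lie_lie_eq_zero]
  have h3 : ∀ t : ℝ, ∑ m ∈ Finset.range (2 + 1),
      bchCoeff m • ((expAd 2 x * expAd 2 (t • y) - 1) ^ m) y = y + (2⁻¹ : ℝ) • ⁅x, y⁆ := fun t => by
    simp only [Finset.sum_range_succ, Finset.sum_range_zero, pow_zero, pow_one, pow_two,
      Module.End.mul_apply, Module.End.one_apply]
    rw [h1, h2]
    norm_num [bchCoeff]
  rw [mul]
  simp only [h3, intervalIntegral.integral_const, sub_zero, one_smul]
  abel

theorem neg_mul_two_mul (S : Stratification g 2) (x y : g) : mul 2 (-x) (mul 2 x y) = y := by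
  simp only [S.mul_two, lie_add, lie_smul, neg_lie, S.lie_lie_eq_zero, lie_self, smul_zero]
  module

theorem mul_two_neg_mul (S : Stratification g 2) (x y : g) : mul 2 x (mul 2 (-x) y) = y := by
  simpa using S.neg_mul_two_mul (-x) y

/-- The point is approached from inside along x(tz) as t ↑ 1; linear scaling suffices, no group
dilation is needed. -/
theorem mem_frontier_gaugeBall {x z : g} {r : ℝ} (hr : 0 < r)
    (hz : ‖S.proj 1 z‖ ^ 4 + 16 * ‖S.proj 2 z‖ ^ 2 = r ^ 4) :
    mul 2 x z ∈ frontier (S.gaugeBall x r) := by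
  have hmem : ∀ w, mul 2 x w ∈ S.gaugeBall x r ↔
      ‖S.proj 1 w‖ ^ 4 + 16 * ‖S.proj 2 w‖ ^ 2 < r ^ 4 := fun w => by
    rw [← S.gauge_lt_iff hr.le]
    simp only [gaugeBall, Set.mem_ofPred_eq, S.neg_mul_two_mul]
  refine ⟨?_, fun h => ((hmem z).1 (interior_subset h)).ne hz⟩
  have hc : Continuous fun t : ℝ => mul 2 x (t • z) := by
    simp only [S.mul_two, lie_smul]
    fun_prop
  have ht : Filter.Tendsto (fun t : ℝ => mul 2 x (t • z)) (𝓝[<] 1) (𝓝 (mul 2 x z)) := by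
    have := hc.tendsto 1
    rw [one_smul] at this
    exact this.mono_left nhdsWithin_le_nhds
  refine mem_closure_of_tendsto ht ?_
  filter_upwards [Ioo_mem_nhdsLT (zero_lt_one' ℝ)] with t ht
  rw [hmem, map_smul, map_smul, norm_smul, norm_smul, Real.norm_of_nonneg ht.1.le]
  have h2 : t ^ 2 < 1 := by nlinarith [ht.1, ht.2]
  have h4 : t ^ 4 ≤ t ^ 2 := by nlinarith [sq_nonneg t]
  have hr4 : 0 < r ^ 4 := by positivity
  have h5 := mul_le_mul_of_nonneg_right h4 (show 0 ≤ ‖S.proj 1 z‖ ^ 4 by positivity)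
  calc (t * ‖S.proj 1 z‖) ^ 4 + 16 * (t * ‖S.proj 2 z‖) ^ 2
      = t ^ 4 * ‖S.proj 1 z‖ ^ 4 + t ^ 2 * (16 * ‖S.proj 2 z‖ ^ 2) := by ring
    _ ≤ t ^ 2 * r ^ 4 := by rw [← hz]; linarith
    _ < r ^ 4 := by nlinarith

/-- A half-space contains a gauge ball of given radius that touches its boundary at a given
point. -/
theorem exists_gaugeBall_subset_halfSpace {l : g →L[ℝ] ℝ} (hl : l ≠ 0) (x₀ : g) {r : ℝ}
    (hr : 0 < r) :
    ∃ x₁, x₀ ∈ frontier (S.gaugeBall x₁ r) ∧ ∀ y ∈ S.gaugeBall x₁ r, l x₀ < l y := by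
  let b : g →ₗ[ℝ] g →ₗ[ℝ] g := (LieAlgebra.ad ℝ g : g →ₗ[ℝ] Module.End ℝ g)
  -- the Riesz representations of the functionals on the layers
  have riesz : ∀ (j : ℕ) (m : g →ₗ[ℝ] ℝ), ∃ a : S.layer j, ∀ w : S.layer j, inner ℝ a w = m w :=
    fun j m => ⟨(InnerProductSpace.toDual ℝ (S.layer j)).symm
      (LinearMap.toContinuousLinearMap (m ∘ₗ (S.layer j).subtype)), fun w =>
        InnerProductSpace.toDual_symm_apply⟩
  -- The linear part of w ↦ l(x₀w), split by layers. Replacing x₀ by x₁ changes only the first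
  -- component, by -J z₁, with J u representing w ↦ l([u, w])/2.
  obtain ⟨a₁, ha₁⟩ := riesz 1 (l + (2⁻¹ : ℝ) • (l : g →ₗ[ℝ] ℝ) ∘ₗ b x₀)
  obtain ⟨a₂, ha₂⟩ := riesz 2 l
  let T : (S.layer 1 →L[ℝ] ℝ) →ₗ[ℝ] S.layer 1 :=
    { toFun := (InnerProductSpace.toDual ℝ (S.layer 1)).symm
      map_add' := fun x y => by simp
      map_smul' := fun c x => by simp }
  let J : S.layer 1 →L[ℝ] S.layer 1 := LinearMap.toContinuousLinearMap
    (T ∘ₗ (LinearMap.toContinuousLinearMap (𝕜 := ℝ) (E := S.layer 1) (F' := ℝ)).toLinearMap ∘ₗ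
      ((LinearMap.llcomp ℝ (S.layer 1) g ℝ ((2⁻¹ : ℝ) • (l : g →ₗ[ℝ] ℝ))) ∘ₗ
        (b.compl₂ (S.layer 1).subtype) ∘ₗ (S.layer 1).subtype))
  have hJ : ∀ u w : S.layer 1, inner ℝ (J u) w = 2⁻¹ * l ⁅(u : g), (w : g)⁆ := fun u w =>
    InnerProductSpace.toDual_symm_apply
  have hlie : ∀ x y : g, ⁅x, y⁆ ∈ S.layer 2 := fun x y => by
    have h1 : ⁅x, y⁆ = ⁅(S.proj 1 x : g), (S.proj 1 y : g)⁆ := by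
      conv_lhs => rw [← S.proj_add_proj x, ← S.proj_add_proj y]
      rw [lie_add, S.lie_layer_two_eq_zero _ (S.proj 2 y).2, add_zero, ← lie_skew, lie_add,
        S.lie_layer_two_eq_zero _ (S.proj 2 x).2, add_zero, lie_skew]
    rw [h1]
    exact S.lie_mem_layer le_rfl le_rfl (S.proj 1 x).2 (S.proj 1 y).2
  have hl₂ : a₂ = 0 → ∀ w ∈ S.layer 2, l w = 0 := fun h0 w hw => by
    have := ha₂ ⟨w, hw⟩
    rw [h0, inner_zero_left] at this
    exact this.symm
  obtain ⟨z₁, z₂, c, hc, hz, he₁, he₂⟩ := exists_tangent_point_gaugeSphere (J := J) (a₁ := a₁)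
    (a₂ := a₂) (fun x => by rw [hJ, lie_self, map_zero, mul_zero])
    (fun h0 => ContinuousLinearMap.ext fun u => ext_inner_right ℝ fun w => by
      rw [hJ, hl₂ h0 _ (hlie _ _)]; simp)
    (by
      -- If a₂ = 0, then l kills V₂ and hence all brackets; a₁ = 0 then forces l = 0 on V₁ as well.
      by_contra! h
      refine hl (ContinuousLinearMap.ext fun x => ?_)
      have h1 := ha₁ (S.proj 1 x)
      have h2 : l ⁅x₀, (S.proj 1 x : g)⁆ = 0 := hl₂ h.2 _ (hlie _ _)
      have h3 : (0 : ℝ) = l (S.proj 1 x) + 2⁻¹ * l ⁅x₀, (S.proj 1 x : g)⁆ := by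
        rw [h.1, inner_zero_left] at h1
        exact h1
      rw [← S.proj_add_proj x, map_add, hl₂ h.2 _ (S.proj 2 x).2]
      rw [h2] at h3
      simpa using h3.symm) hr
  set z : g := z₁ + z₂ with hzdef
  have hp₁ : S.proj 1 z = z₁ := Subtype.ext (by
    rw [hzdef, map_add, Submodule.coe_add, S.proj_of_mem z₁.2, S.proj_of_mem z₂.2]; simp)
  have hp₂ : S.proj 2 z = z₂ := Subtype.ext (by
    rw [hzdef, map_add, Submodule.coe_add, S.proj_of_mem z₁.2, S.proj_of_mem z₂.2]; simp)
  -- This is x₀(-z), the solution of x₁z = x₀. Up to central terms it is x₀ - z₁.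
  let x₁ : g := x₀ - z - (2⁻¹ : ℝ) • ⁅x₀, z⁆
  have hlx₁ : ∀ w : g, ⁅x₁, w⁆ = ⁅x₀, w⁆ - ⁅(z₁ : g), w⁆ := fun w => by
    have h1 : ⁅⁅x₀, z⁆, w⁆ = 0 := by rw [← lie_skew, S.lie_lie_eq_zero, neg_zero]
    have h2 : ⁅(z₂ : g), w⁆ = 0 := by rw [← lie_skew, S.lie_layer_two_eq_zero _ z₂.2, neg_zero]
    simp only [x₁, hzdef, sub_lie, smul_lie, add_lie, h2]
    rw [← hzdef, h1]
    simp
  have hx₁ : mul 2 x₁ z = x₀ := by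
    have h1 : ⁅(z₁ : g), z⁆ = 0 := by
      rw [hzdef, lie_add, lie_self, S.lie_layer_two_eq_zero _ z₂.2, add_zero]
    rw [S.mul_two, hlx₁, h1]
    simp only [x₁, sub_zero]
    abel
  refine ⟨x₁, ?_, fun y hy => ?_⟩
  · have := S.mem_frontier_gaugeBall (x := x₁) (z := z) hr (by rw [hp₁, hp₂, hz])
    rwa [hx₁] at this
  · obtain ⟨w, rfl⟩ : ∃ w, mul 2 x₁ w = y := ⟨_, S.mul_two_neg_mul x₁ y⟩
    have hw : ‖S.proj 1 w‖ ^ 4 + 16 * ‖S.proj 2 w‖ ^ 2 < r ^ 4 := by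
      rw [← S.gauge_lt_iff hr.le]
      simpa only [gaugeBall, Set.mem_ofPred_eq, S.neg_mul_two_mul] using hy
    set w₁ := S.proj 1 w
    set w₂ := S.proj 2 w
    have hwdef : w = w₁ + w₂ := (S.proj_add_proj w).symm
    rw [← hz] at hw
    have hlt := gauge_inner_lt hw
    have hdiff : l (mul 2 x₁ w) - l x₀ =
        inner ℝ (a₁ - J z₁) (w₁ - z₁) + inner ℝ a₂ (w₂ - z₂) := by
      have h1 := ha₁ (w₁ - z₁)
      have h2 := ha₂ (w₂ - z₂)
      have h3 := hJ z₁ (w₁ - z₁)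
      rw [inner_sub_left, h1, h2, h3]
      rw [show l x₀ = l (mul 2 x₁ z) by rw [hx₁]]
      have h4 : ∀ (u : S.layer 1) (v : S.layer 2), l (mul 2 x₁ (u + v)) = l x₁ + l u + l v +
          2⁻¹ * (l ⁅x₀, (u : g)⁆ - l ⁅(z₁ : g), (u : g)⁆) := fun u v => by
        rw [S.mul_two, hlx₁, lie_add, lie_add, S.lie_layer_two_eq_zero _ v.2,
          S.lie_layer_two_eq_zero _ v.2]
        simp
        ring
      rw [hwdef, hzdef, h4, h4]
      simp [b]
      ring
    -- By the choice of z the difference is -c times the expression that `gauge_inner_lt` shows to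
    -- be negative.
    rw [he₁, he₂, inner_neg_left, inner_neg_left, inner_smul_left, inner_smul_left] at hdiff
    simp only [conj_trivial] at hdiff
    nlinarith

/-- The outer gauge ball condition for convex sets, with arbitrary radius. -/
theorem hasOuterGaugeBall {D : Set g} (hD : Convex ℝ D) {x₀ : g} (hx₀ : x₀ ∈ frontier D) {r : ℝ}
    (hr : 0 < r) : S.HasOuterGaugeBall D x₀ r := by
  obtain ⟨l, hl, hlD⟩ := exists_supporting_functional hD hx₀
  obtain ⟨x₁, hx₁, hball⟩ := S.exists_gaugeBall_subset_halfSpace hl x₀ hr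
  refine ⟨x₁, hx₁, Set.eq_empty_of_forall_notMem ?_⟩
  rintro y ⟨hy, hyD⟩
  exact (hball y hy).not_ge (hlD y hyD)

end StepTwo

end Stratification

end Carnot

/-- Let `g` be a Lie algebra of odd dimension (with an auxiliary Euclidean structure).
Tangency: for every stratification of `g`, every smooth open set is tangent to every nonempty
`T`-family. Step two: every convex set has, at each boundary point and for each radius, an outer
tangent gauge pseudo-ball, and every bounded convex set satisfies the uniform outer gauge
pseudo-ball condition. -/
theorem mainTheorem12 {g : Type*} [Carnot.NormedLieRing g] [Carnot.EuclideanLieAlgebra g]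
    [FiniteDimensional ℝ g] (hodd : Odd (Module.finrank ℝ g)) :
    (∀ (k : ℕ) (S : Carnot.Stratification g k) (D : Set g) (ℱ : Set (Set g)),
      Carnot.IsSmoothOpen D → S.IsTFamily ℱ → ℱ.Nonempty → Carnot.IsTangentTo D ℱ) ∧
    (∀ S : Carnot.Stratification g 2,
      (∀ D : Set g, Convex ℝ D → ∀ x₀ ∈ frontier D, ∀ r : ℝ, 0 < r →
        S.HasOuterGaugeBall D x₀ r) ∧
      (∀ D : Set g, Convex ℝ D → Bornology.IsBounded D → S.UniformOuterGaugeBall D)) :=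
  ⟨fun _ S _ _ hD hℱ hne => S.isTangentTo hodd hD hℱ hne, fun S =>
    ⟨fun _ hD _ hx₀ _ hr => S.hasOuterGaugeBall hD hx₀ hr, fun _ hD _ =>
      -- Every radius is admissible, so any positive `R₀` would do.
      ⟨1, one_pos, fun _ hx₀ _ hr _ => S.hasOuterGaugeBall hD hx₀ hr⟩⟩⟩
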